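/- **Setting.** Let $\Omega$ be a measurable space with a countable family of measurable sets separating its points (for instance a standard Borel space), $G_0$ a finite nonzero measure on $\Omega$ giving mass $0$ to every point, $\gamma_0=G_0(\Omega)$, and $\rho$ a measure on $(0,\infty)$ with $\rho\neq 0$ and $\int_0^\infty\min\{1,r\}\,\rho(dr)<\infty$. Let $G=\sum_k r_k\delta_{\omega_k}$ (at most countably many atoms, a.s. distinct, $r_k>0$) be a completely random measure on $\Omega$ with Lévy measure $\rho(dr)G_0(d\omega)$: a.s. $G(\Omega)<\infty$, the masses of disjoint measurable sets are independent, and $\mathbb E[e^{iuG(A)}]=\exp\big(\int\!\int_{(0,\infty)\times A}(e^{iur}-1)\rho(dr)G_0(d\omega)\big)$. In the count-mixture model, given $G$, the sample size $M$ is Poisson with mean $G(\Omega)$, and given $G$ and $M=m$ the cluster indicators of the $m$ elements are i.i.d. with law $\sum_k \frac{r_k}{G(\Omega)}\delta_k$. The ties between the indicators partition the sample into clusters. Write $f_M(m)=P(M=m)$. Let $\boldsymbol z=(z_1,\dots,z_j)$ be labels that encode a partition of the first $j$ elements, and let $m'\ge j$. Then $f(\boldsymbol z,m')$ denotes the joint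 probability that $M=m'$ and that the first $j$ elements are partitioned as in $\boldsymbol z$ (for $j=m'$ this is the ECPF), and $f(\boldsymbol z\mid m')$ denotes the conditional probability, given $M=m'$, that the first $j$ elements are partitioned as in $\boldsymbol z$ (for $j=m'$ this is the EPPF). For $n\ge 1$ put $\kappa_n=\int_0^\infty r^n e^{-r}\rho(dr)$. **Corollary (Size-Dependent EPPF).** Let $m\ge 0$ and let $\boldsymbol z=(z_1,\dots,z_m)$ have exactly $l$ clusters, labelled $1,\dots,l$, with sizes $n_1,\dots,n_l\geq 1$. Then $\kappa_n>0$ for every $n\ge1$, and $f_M(m)$, $f_M(m+1)$, $f(\boldsymbol z,m+1)$ are positive. In a sample of size $m+1$, the probability function of $\boldsymbol z$ is $$f(\boldsymbol z\mid m+1)=f(\boldsymbol z\mid m)\,\frac{f_M(m)}{(m+1)\,f_M(m+1)}\Big(\gamma_0\kappa_1+\sum_{k=1}^{l}\frac{\kappa_{n_k+1}}{\kappa_{n_k}}\Big).$$ Given $M=m+1$ and the partition $\boldsymbol z$ of the first $m$ elements, the new element is clustered with the prediction rule $$f(z_{m+1}=k\mid\boldsymbol z,m+1)=\frac{f(\boldsymbol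 z,z_{m+1}=k,m+1)}{f(\boldsymbol z,m+1)},\qquad k=1,\dots,l+1,$$ where $k\le l$ means joining cluster $k$ and $k=l+1$ means opening a new cluster. This probability equals $w_k/\sum_{k'=1}^{l+1}w_{k'}$ with $w_k=\kappa_{n_k+1}/\kappa_{n_k}$ for $k\le l$ and $w_{l+1}=\gamma_0\kappa_1$. -/

import Mathlib

open MeasureTheory ProbabilityTheory Set
open scoped NNReal ENNReal

noncomputable section

namespace CountMixture

variable {S Ω : Type*} [MeasurableSpace S] [MeasurableSpace Ω]

/-- A completely random measure `G` on `Ω` with almost surely finite total mass and Lévy measure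
`ν` on `ℝ₊ × Ω`: the masses of disjoint measurable sets are independent, and
`E[exp (i u G(A))] = exp (∫∫_{ℝ₊ × A} (exp (i u r) - 1) ν(dr dω))`. -/
structure IsCompletelyRandomMeasure (P : Measure S) (G : S → Measure Ω) (ν : Measure (ℝ × Ω)) :
    Prop where
  measurable : Measurable G
  finite : ∀ᵐ s ∂P, G s univ < ∞
  indep : ∀ (n : ℕ) (A : Fin n → Set Ω), (∀ i, MeasurableSet (A i)) →
    Pairwise (fun i j => Disjoint (A i) (A j)) → iIndepFun (fun i s => G s (A i)) P
  charFun_eq : ∀ A : Set Ω, MeasurableSet A → ∀ u : ℝ,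
    ∫ s, Complex.exp (Complex.I * (u : ℂ) * (((G s A).toReal : ℝ) : ℂ)) ∂P =
      Complex.exp (∫ x in univ ×ˢ A, (Complex.exp (Complex.I * (u : ℂ) * (x.1 : ℂ)) - 1) ∂ν)

/-- The homogeneous Lévy measure `ν(dr dω) = ρ(dr) G₀(dω)`. Only the restriction of `ρ` to
`(0, ∞)` plays a role. -/
def levyMeasure (ρ : Measure ℝ) (G₀ : Measure Ω) : Measure (ℝ × Ω) :=
  (ρ.restrict (Ioi 0)).prod G₀

/-- The random measure `G = ∑ₖ rₖ δ_{ωₖ}`. Indices with `rₖ = 0` carry no atom, so the number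
`K ≤ ∞` of atoms may be finite and random. -/
def atomicMeasure (r : ℕ → S → ℝ≥0) (loc : ℕ → S → Ω) (s : S) : Measure Ω :=
  Measure.sum fun k => (r k s : ℝ≥0∞) • Measure.dirac (loc k s)

/-- The count-mixture model: `G = ∑ₖ rₖ δ_{ωₖ}` is a completely random measure, with distinct atoms
`ωₖ` and Lévy measure `ρ(dr) G₀(dω)`; given `G`, the sample size `M` is Poisson with mean `G(Ω)`;
and given `G` and `M = m`, the cluster indicators `Z₀, …, Z_{m-1}` are independent with law
`∑ₖ (rₖ / G(Ω)) δₖ`. The indicators `Zᵢ` with `i ≥ M` are not part of the sample and are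
unconstrained. -/
structure IsCountMixture (P : Measure S) (ρ : Measure ℝ) (G₀ : Measure Ω)
    (r : ℕ → S → ℝ≥0) (loc : ℕ → S → Ω) (M : S → ℕ) (Z : ℕ → S → ℕ) : Prop where
  measurable_weight : ∀ k, Measurable (r k)
  measurable_loc : ∀ k, Measurable (loc k)
  measurable_size : Measurable M
  measurable_indicator : ∀ i, Measurable (Z i)
  distinct_atoms : ∀ᵐ s ∂P, ∀ j k, r j s ≠ 0 → r k s ≠ 0 → loc j s = loc k s → j = k
  crm : IsCompletelyRandomMeasure P (atomicMeasure r loc) (levyMeasure ρ G₀)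
  sample : ∀ (m : ℕ) (z : Fin m → ℕ),
    P[indicator {s | M s = m ∧ ∀ i : Fin m, Z i s = z i} (fun _ => (1 : ℝ)) |
        MeasurableSpace.comap (fun s (k : ℕ) => (r k s, loc k s)) inferInstance] =ᵐ[P]
      fun s => (poissonMeasure (atomicMeasure r loc s univ).toNNReal).real {m} *
        ∏ i, (r (z i) s : ℝ) / (atomicMeasure r loc s univ).toReal

/-- Two sequences of labels define the same partition of the index set: the ties agree. -/
def SameTies {j : ℕ} {α β : Type*} (x : Fin j → α) (z : Fin j → β) : Prop :=
  ∀ a b, x a = x b ↔ z a = z b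

/-- The event that the ties between the first `j` cluster indicators are those of `z`. -/
def tiesEvent (Z : ℕ → S → ℕ) {j : ℕ} {α : Type*} (z : Fin j → α) : Set S :=
  {s | SameTies (fun i : Fin j => Z i s) z}

/-- `f_M(m)`, the probability mass function of the sample size. -/
def sizePMF (P : Measure S) (M : S → ℕ) (m : ℕ) : ℝ := P.real {s | M s = m}

/-- `f(z_{1:j}, m)`, for `j ≤ m`: the joint probability of sample size `m` and of the partition of
the first `j` elements given by `z`. For `j = m` this is the exchangeable cluster probability
function. -/
def ecpf (P : Measure S) (M : S → ℕ) (Z : ℕ → S → ℕ) (m : ℕ) {j : ℕ} {α : Type*}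
    (z : Fin j → α) : ℝ :=
  P.real ({s | M s = m} ∩ tiesEvent Z z)

/-- `f(z_{1:j} | m)`, for `j ≤ m`: the conditional probability, given sample size `m`, of the
partition of the first `j` elements given by `z`. For `j = m` this is the exchangeable partition
probability function, for `j < m` the size-dependent one. -/
def eppf (P : Measure S) (M : S → ℕ) (Z : ℕ → S → ℕ) (m : ℕ) {j : ℕ} {α : Type*}
    (z : Fin j → α) : ℝ :=
  (cond P {s | M s = m}).real (tiesEvent Z z)

/-- The labels `(z₁, …, z_m, k)` after one more element has been added: `k : Fin (l + 1)` is one of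
the `l` old clusters, or `Fin.last l` for a new cluster. -/
def addElement {m l : ℕ} (z : Fin m → Fin l) (k : Fin (l + 1)) : Fin (m + 1) → Fin (l + 1) :=
  Fin.snoc (α := fun _ => Fin (l + 1)) (fun i => (z i).castSucc) k

/-- `f(z_{m+1} = k | z, m + 1)`: given that the sample size is `m + 1` and that the first `m`
elements are clustered as in `z`, the conditional probability that the last one joins `k`. -/
def predictive (P : Measure S) (M : S → ℕ) (Z : ℕ → S → ℕ) {m l : ℕ}
    (z : Fin m → Fin l) (k : Fin (l + 1)) : ℝ :=
  (cond P ({s | M s = m + 1} ∩ tiesEvent Z z)).real (tiesEvent Z (addElement z k))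

/-- `n_k`, the number of elements in cluster `k`. -/
def clusterSize {m l : ℕ} (z : Fin m → Fin l) (k : Fin l) : ℕ :=
  (Finset.univ.filter fun i => z i = k).card

/-- `∫₀^∞ rⁿ e^{-r} ρ(dr)`. -/
def kappa (ρ : Measure ℝ) (n : ℕ) : ℝ := ∫ r in Ioi (0 : ℝ), r ^ n * Real.exp (-r) ∂ρ

/-- The unnormalized weight of each possible label of a new element: `κ(n_k + 1) / κ(n_k)` for an
old cluster `k`, and `γ₀ κ(1)` for a new cluster. -/
def predictionWeight (γ₀ : ℝ) (ρ : Measure ℝ) {m l : ℕ} (z : Fin m → Fin l) : Fin (l + 1) → ℝ :=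
  Fin.snoc (α := fun _ => ℝ)
    (fun k => kappa ρ (clusterSize z k + 1) / kappa ρ (clusterSize z k)) (γ₀ * kappa ρ 1)

end CountMixture

end

open CountMixture

/-! Everything follows from a product formula for the ECPF, `ecpf_eq_prod`: for a partition with
block sizes $n_1,\dots,n_l$, $f(\boldsymbol
z,m)=\frac{1}{m!}e^{\gamma_0\int(e^{-r}-1)\rho(dr)}\prod_j\gamma_0\kappa_{n_j}$. Adding an element
to block $k$ replaces $\kappa_{n_k}$ by $\kappa_{n_k+1}$; a new block contributes
$\gamma_0\kappa_1$. Both are accompanied by the same factor $1/(m+1)$, so the weights $w_k$ are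
ratios of ECPFs, and summing over $k$ gives $f(\boldsymbol z,m+1)$.

For the product formula, the Poisson weight cancels the normalization of the indicators, so the
probability that $M=m$ and that the $i$-th sampled atom lies in $A_i$ is
$\frac1{m!}E[e^{-G(\Omega)}\prod_iG(A_i)]$ (`measureReal_sample_mem`). Ties between indicators are
approximated by ties between cells of ever finer finite partitions of $\Omega$: blocks are assigned
injectively to cells, and independence over cells splits the expectation into one tilted moment per
cell.

With $a=G_0(A)$, the $n$-th such moment, $n\ge1$, is $a\kappa_n+O(a^2)$
(`exists_abs_normalizedMoment_sub_le`). Since $G_0$ has no atoms, $\sum_A G_0(A)^2\to0$ over the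
cells, so both the errors and the injectivity constraint disappear in the limit, leaving
$\prod_j\gamma_0\kappa_{n_j}$. The moment expansion comes from differentiating the Laplace transform
at $-1$; the model only gives the characteristic function, which `complexMGF_eq_exp_levyExponent`
extends to the left half-plane. -/

namespace CountMixture

open Filter Topology

noncomputable section

/-! ### Lévy exponents on the left half-plane. -/

lemma norm_exp_sub_one_le_of_re_nonpos {w : ℂ} (hw : w.re ≤ 0) : ‖Complex.exp w - 1‖ ≤ ‖w‖ := by
  -- Mean value inequality: the derivative of `exp` has norm at most 1 on this convex set.
  have h := (convex_halfSpace_re_le (0 : ℝ)).norm_image_sub_le_of_norm_deriv_le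
    (f := Complex.exp) (C := 1) (x := 0) (y := w)
    (fun x _ => Complex.differentiableAt_exp) (fun x hx => by
      simpa [Complex.norm_exp] using hx) (by simp) hw
  simpa using h

/-- Lets the one integrable function `min 1 r` dominate integrands with a linear factor and
exponential decay. -/
lemma mul_exp_neg_mul_le {ε r : ℝ} (hε0 : 0 < ε) (hr : 0 < r) :
    r * Real.exp (-(ε * r)) ≤ max 1 ε⁻¹ * min 1 r := by
  rcases le_total 1 r with h3 | h3
  · rw [min_eq_left h3, mul_one]
    refine le_trans ?_ (le_max_right _ _)
    have h4 := Real.add_one_le_exp (ε * r)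
    rw [Real.exp_neg, ← div_eq_mul_inv, div_le_iff₀ (Real.exp_pos _), ← div_eq_inv_mul,
      le_div_iff₀ hε0]
    linarith
  · rw [min_eq_right h3, mul_comm]
    have h4 : Real.exp (-(ε * r)) ≤ 1 := Real.exp_le_one_iff.2 (by
      have := mul_pos hε0 hr; linarith)
    gcongr
    exact h4.trans (le_max_left _ _)

/-- The cumulant exponent `∫ (exp (w r) - 1) ν(dr)` of a Lévy measure on the positive half-line. -/
def levyExponent (ν : Measure ℝ) (w : ℂ) : ℂ := ∫ r, (Complex.exp (w * (r : ℂ)) - 1) ∂ν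

/-- A measure on the positive half-line that integrates `min 1 r`. -/
structure IsSubordinatorMeasure (ν : Measure ℝ) : Prop where
  pos : ∀ᵐ r : ℝ ∂ν, 0 < r
  integrable : Integrable (fun r : ℝ => min 1 r) ν

lemma isSubordinatorMeasure_restrict {ρ : Measure ℝ}
    (hρ : ∫⁻ r in Ioi (0 : ℝ), ENNReal.ofReal (min 1 r) ∂ρ < ∞) :
    IsSubordinatorMeasure (ρ.restrict (Ioi 0)) := by
  have hpos : ∀ᵐ r ∂(ρ.restrict (Ioi 0)), (0 : ℝ) < r := ae_restrict_mem measurableSet_Ioi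
  refine ⟨hpos, (by fun_prop : Measurable fun r : ℝ => min 1 r).aestronglyMeasurable, ?_⟩
  rw [hasFiniteIntegral_iff_ofReal]
  · exact hρ
  · filter_upwards [hpos] with r hr using (lt_min one_pos hr).le

namespace IsSubordinatorMeasure

variable {ν : Measure ℝ} (h : IsSubordinatorMeasure ν)
include h

/-- Weighting by `min 1 r`, positive a.e., gives a finite measure, from which `ν` is recovered by
the inverse density. Fubini for the Lévy measure needs this. -/
lemma sFinite : SFinite ν := by
  set f : ℝ → ℝ≥0∞ := fun r => ENNReal.ofReal (min 1 r) with hf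
  have hfm : Measurable f := by fun_prop
  have hfin : IsFiniteMeasure (ν.withDensity f) := by
    refine isFiniteMeasure_withDensity ?_
    have := h.integrable.lintegral_lt_top
    exact this.ne
  have h1 : (ν.withDensity f).withDensity f⁻¹ = ν := by
    refine withDensity_inv_same hfm ?_ ?_
    · filter_upwards [h.pos] with r hr
      simp [hf, hr]
    · exact ae_of_all _ fun r => ENNReal.ofReal_ne_top
  rw [← h1]
  infer_instance

lemma norm_exp_sub_one_le {w : ℂ} (hw : w.re ≤ 0) :
    ∀ᵐ r : ℝ ∂ν, ‖Complex.exp (w * (r : ℂ)) - 1‖ ≤ max 2 ‖w‖ * min 1 r := by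
  filter_upwards [h.pos] with r hr
  have hre : (w * (r : ℂ)).re ≤ 0 := by
    simpa using mul_nonpos_of_nonpos_of_nonneg hw hr.le
  rcases le_total 1 r with h1 | h1
  · rw [min_eq_left h1, mul_one]
    refine le_trans ?_ (le_max_left _ _)
    refine (norm_sub_le _ _).trans ?_
    have : ‖Complex.exp (w * (r : ℂ))‖ ≤ 1 := by
      rw [Complex.norm_exp]; exact Real.exp_le_one_iff.2 hre
    rw [norm_one]; linarith
  · rw [min_eq_right h1]
    refine (norm_exp_sub_one_le_of_re_nonpos hre).trans ?_
    rw [norm_mul, Complex.norm_real, Real.norm_of_nonneg hr.le]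
    gcongr
    exact le_max_right _ _

lemma integrable_exp_sub_one {w : ℂ} (hw : w.re ≤ 0) :
    Integrable (fun r : ℝ => Complex.exp (w * (r : ℂ)) - 1) ν :=
  (h.integrable.const_mul (max 2 ‖w‖)).mono'
    (by fun_prop) (h.norm_exp_sub_one_le hw)

lemma continuousOn_levyExponent : ContinuousOn (levyExponent ν) {w | w.re ≤ 0} := by
  intro w hw
  refine continuousWithinAt_of_dominated (bound := fun r => max 2 (‖w‖ + 1) * min 1 r)
    ?_ ?_ (h.integrable.const_mul _) ?_
  · exact Eventually.of_forall fun z => by fun_prop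
  · have : ∀ᶠ z in 𝓝[{w : ℂ | w.re ≤ 0}] w, ‖z‖ < ‖w‖ + 1 :=
      (continuous_norm.tendsto w).mono_left nhdsWithin_le_nhds |>.eventually_lt_const (by simp)
    filter_upwards [this, self_mem_nhdsWithin] with z hz hz0
    filter_upwards [h.norm_exp_sub_one_le hz0, h.pos] with r hr hr0
    refine hr.trans ?_
    have : 0 ≤ min 1 r := (lt_min one_pos hr0).le
    gcongr
  · exact ae_of_all _ fun r => by fun_prop

lemma re_levyExponent_nonpos {w : ℂ} (hw : w.re ≤ 0) : (levyExponent ν w).re ≤ 0 := by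
  have h1 := integral_re (h.integrable_exp_sub_one hw)
  simp only [RCLike.re_eq_complex_re] at h1
  rw [levyExponent, ← h1]
  refine integral_nonpos_of_ae ?_
  filter_upwards [h.pos] with r hr
  have hre : (w * (r : ℂ)).re ≤ 0 := by
    simpa using mul_nonpos_of_nonpos_of_nonneg hw hr.le
  have := (Complex.re_le_norm (Complex.exp (w * (r : ℂ)))).trans
    ((Complex.norm_exp _).le.trans (Real.exp_le_one_iff.2 hre))
  simpa using this

lemma hasDerivAt_levyExponent {w : ℂ} (hw : w.re < 0) :
    HasDerivAt (levyExponent ν) (∫ r, (r : ℂ) * Complex.exp (w * (r : ℂ)) ∂ν) w := by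
  -- Half the distance from `w` to the imaginary axis, so that `re z < -ε` is a neighbourhood of `w`
  -- with uniform decay.
  set ε : ℝ := -w.re / 2 with hε
  have hε0 : 0 < ε := by rw [hε]; linarith
  refine (hasDerivAt_integral_of_dominated_loc_of_deriv_le (s := {z : ℂ | z.re < -ε})
    (bound := fun r => max 1 ε⁻¹ * min 1 r)
    (F := fun (z : ℂ) (r : ℝ) => Complex.exp (z * (r : ℂ)) - 1)
    (F' := fun (z : ℂ) (r : ℝ) => (r : ℂ) * Complex.exp (z * (r : ℂ))) ?_ ?_ ?_ ?_ ?_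
    (h.integrable.const_mul _) ?_).2
  · refine (isOpen_lt Complex.continuous_re continuous_const).mem_nhds ?_
    change w.re < -ε
    rw [hε]; linarith
  · exact Eventually.of_forall fun z => by fun_prop
  · exact h.integrable_exp_sub_one hw.le
  · fun_prop
  · filter_upwards [h.pos] with r hr z hz
    have hz' : z.re < -ε := hz
    rw [norm_mul, Complex.norm_real, Real.norm_of_nonneg hr.le, Complex.norm_exp]
    have h1 : (z * (r : ℂ)).re ≤ -(ε * r) := by
      simp only [Complex.re_mul_ofReal]; nlinarith
    have h2 : Real.exp (z * (r : ℂ)).re ≤ Real.exp (-(ε * r)) := Real.exp_le_exp.2 h1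
    exact (mul_le_mul_of_nonneg_left h2 hr.le).trans (mul_exp_neg_mul_le hε0 hr)
  · refine ae_of_all _ fun r z _ => ?_
    have := ((hasDerivAt_id z).mul_const (r : ℂ)).cexp.sub_const 1
    simpa [mul_comm] using this

end IsSubordinatorMeasure

lemma interior_integrableExpSet_of_nonneg {S : Type*} [MeasurableSpace S] {P : Measure S}
    [IsFiniteMeasure P] {X : S → ℝ} (hX : Measurable X) (hX0 : ∀ s, 0 ≤ X s) {t : ℝ} (ht : t < 0) :
    t ∈ interior (integrableExpSet X P) := by
  rw [mem_interior]
  refine ⟨Iio 0, fun u hu => ?_, isOpen_Iio, ht⟩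
  refine (integrable_const (1 : ℝ)).mono' (by fun_prop) (ae_of_all _ fun s => ?_)
  rw [Real.norm_of_nonneg (Real.exp_pos _).le]
  exact Real.exp_le_one_iff.2 (mul_nonpos_of_nonpos_of_nonneg (le_of_lt hu) (hX0 s))

/-! ### From the characteristic function to the Laplace transform. -/

section Laplace

variable {S : Type*} [MeasurableSpace S] {P : Measure S} [IsProbabilityMeasure P]
  {X : S → ℝ} {ν : Measure ℝ} {a : ℝ}

lemma norm_exp_mul_le_one {w : ℂ} (hw : w.re ≤ 0) {x : ℝ} (hx : 0 ≤ x) :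
    ‖Complex.exp (w * (x : ℂ))‖ ≤ 1 := by
  rw [Complex.norm_exp]
  exact Real.exp_le_one_iff.2 (by simpa using mul_nonpos_of_nonpos_of_nonneg hw hx)

lemma continuousOn_complexMGF_of_nonneg (hX : Measurable X) (hX0 : ∀ s, 0 ≤ X s) :
    ContinuousOn (complexMGF X P) {w | w.re ≤ 0} := by
  intro w hw
  refine continuousWithinAt_of_dominated (bound := fun _ => 1)
    ?_ ?_ (integrable_const _) ?_
  · exact Eventually.of_forall fun z => by fun_prop
  · filter_upwards [self_mem_nhdsWithin] with z hz0
    exact ae_of_all _ fun s => norm_exp_mul_le_one hz0 (hX0 s)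
  · exact ae_of_all _ fun r => by fun_prop

lemma norm_complexMGF_le_one (hX0 : ∀ s, 0 ≤ X s) {w : ℂ} (hw : w.re ≤ 0) :
    ‖complexMGF X P w‖ ≤ 1 := by
  refine (norm_integral_le_of_norm_le_const (C := 1)
    (ae_of_all _ fun s => norm_exp_mul_le_one hw (hX0 s))).trans (by simp)

/-- A Lévy–Khintchine formula on the imaginary axis extends to the left half-plane. -/
theorem complexMGF_eq_exp_levyExponent (hX : Measurable X) (hX0 : ∀ s, 0 ≤ X s)
    (hν : IsSubordinatorMeasure ν) (ha : 0 ≤ a)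
    (hchar : ∀ u : ℝ, complexMGF X P (u * Complex.I) =
      Complex.exp (a * levyExponent ν (u * Complex.I)))
    {w : ℂ} (hw : w.re ≤ 0) :
    complexMGF X P w = Complex.exp (a * levyExponent ν w) := by
  -- The sign change moves the problem to the right half-plane, where Phragmén–Lindelöf applies.
  set f : ℂ → ℂ := fun z => complexMGF X P (-z) - Complex.exp (a * levyExponent ν (-z)) with hf
  have hbound : ∀ z : ℂ, 0 ≤ z.re → ‖f z‖ ≤ 2 := fun z hz => by
    have hz' : (-z).re ≤ 0 := by simpa using hz
    refine (norm_sub_le _ _).trans ?_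
    have h1 := norm_complexMGF_le_one (P := P) hX0 hz'
    have h2 : ‖Complex.exp (a * levyExponent ν (-z))‖ ≤ 1 := by
      rw [Complex.norm_exp]
      refine Real.exp_le_one_iff.2 ?_
      simpa using mul_nonpos_of_nonneg_of_nonpos ha (hν.re_levyExponent_nonpos hz')
    linarith
  have hmaps : MapsTo (fun z : ℂ => -z) {z | 0 ≤ z.re} {w | w.re ≤ 0} := fun z hz => by
    simpa using hz
  have hd : DiffContOnCl ℂ f {z | 0 < z.re} := by
    constructor
    · intro z hz
      have hz' : (-z).re < 0 := by simpa using hz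
      have h1 : DifferentiableAt ℂ (complexMGF X P) (-z) :=
        (hasDerivAt_complexMGF (interior_integrableExpSet_of_nonneg hX hX0 hz')).differentiableAt
      have h2 := (hν.hasDerivAt_levyExponent hz').differentiableAt
      refine DifferentiableAt.differentiableWithinAt (DifferentiableAt.sub ?_ ?_)
      · exact h1.comp z differentiableAt_id.neg
      · exact ((h2.comp z differentiableAt_id.neg).const_mul _).cexp
    · rw [Complex.closure_setOfPred_lt_re]
      refine ContinuousOn.sub ?_ ?_
      · exact (continuousOn_complexMGF_of_nonneg hX hX0).comp continuous_neg.continuousOn hmaps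
      · refine Complex.continuous_exp.comp_continuousOn (continuousOn_const.mul ?_)
        exact hν.continuousOn_levyExponent.comp continuous_neg.continuousOn hmaps
  have key : ‖f (-w)‖ ≤ 0 := by
    -- `f` is bounded by 2 on the closed half-plane and vanishes on the imaginary axis, so the
    -- boundary bound 0 propagates inside. Boundedness is growth of order 1 with rate 0.
    refine PhragmenLindelof.right_half_plane_of_bounded_on_real hd ⟨1, by norm_num, 0, ?_⟩ ?_ ?_
      (by simpa using hw)
    · refine Asymptotics.IsBigO.of_bound 2 ?_
      filter_upwards [mem_inf_of_right (mem_principal_self _)] with z hz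
      simpa using hbound z (le_of_lt hz)
    · refine ⟨2, ?_⟩
      simp only [eventually_map]
      filter_upwards [eventually_ge_atTop 0] with x hx
      exact hbound _ (by simpa using hx)
    · intro x
      have := hchar (-x)
      simp only [Complex.ofReal_neg, neg_mul] at this
      simp [hf, this]
  have := norm_le_zero_iff.1 key
  simp only [hf, neg_neg] at this
  exact sub_eq_zero.1 this

end Laplace

/-- `∫ rⁿ e^{-r} ν(dr)`. -/
def tiltedMoment (ν : Measure ℝ) (n : ℕ) : ℝ := ∫ r, r ^ n * Real.exp (-r) ∂ν

/-! ### Tilted moments as derivatives of the Lévy exponent. -/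

namespace IsSubordinatorMeasure

variable {ν : Measure ℝ} (h : IsSubordinatorMeasure ν)
include h

lemma integrable_pow_mul_exp_neg (n : ℕ) :
    Integrable (fun r : ℝ => r ^ (n + 1) * Real.exp (-r)) ν := by
  refine (h.integrable.const_mul ((n + 1).factorial : ℝ)).mono' (by fun_prop) ?_
  filter_upwards [h.pos] with r hr
  rw [Real.norm_of_nonneg (by positivity)]
  have h1 : (1 : ℝ) ≤ (n + 1).factorial := by exact_mod_cast (n + 1).factorial_pos
  rcases le_total 1 r with h2 | h2
  · rw [min_eq_left h2, mul_one, Real.exp_neg, ← div_eq_mul_inv, div_le_iff₀ (Real.exp_pos _),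
      ← div_le_iff₀' (by positivity)]
    exact Real.pow_div_factorial_le_exp r hr.le _
  · rw [min_eq_right h2]
    have h3 : Real.exp (-r) ≤ 1 := Real.exp_le_one_iff.2 (by linarith)
    have h4 : r ^ (n + 1) ≤ r := by
      rw [pow_succ]; exact mul_le_of_le_one_left hr.le (pow_le_one₀ hr.le h2)
    calc r ^ (n + 1) * Real.exp (-r) ≤ r * 1 := by gcongr
      _ ≤ (n + 1).factorial * r := by rw [mul_comm]; gcongr

lemma tiltedMoment_nonneg (n : ℕ) : 0 ≤ tiltedMoment ν n := by
  refine integral_nonneg_of_ae ?_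
  filter_upwards [h.pos] with r hr
  simp only [Pi.zero_apply]
  positivity

lemma tiltedMoment_pos (hν : ν ≠ 0) (n : ℕ) : 0 < tiltedMoment ν (n + 1) := by
  have h0 : 0 ≤ᵐ[ν] fun r : ℝ => r ^ (n + 1) * Real.exp (-r) := by
    filter_upwards [h.pos] with r hr
    simp only [Pi.zero_apply]
    positivity
  refine (integral_pos_iff_support_of_nonneg_ae h0 (h.integrable_pow_mul_exp_neg n)).2 ?_
  refine pos_iff_ne_zero.2 fun h1 => hν ?_
  rw [← Measure.measure_univ_eq_zero, 
    ← compl_union_self (Function.support fun r : ℝ => r ^ (n + 1) * Real.exp (-r))]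
  refine measure_union_null ?_ h1
  refine measure_mono_null ?_ h.pos
  intro r hr
  simp only [mem_compl_iff, Function.mem_support, not_not] at hr
  have : r = 0 := by simpa using hr
  simp [this]

/-- Tilting by `r * exp (-r)` moves the point `-1` to `0`, an interior point of the domain of the
new moment generating function, whose iterated derivatives there are moments. -/
lemma deriv_levyExponent {w : ℂ} (hw : w.re < 0) :
    deriv (levyExponent ν) w = complexMGF id
      (ν.withDensity fun r => ((r * Real.exp (-r)).toNNReal : ℝ≥0∞)) (w + 1) := by
  rw [(h.hasDerivAt_levyExponent hw).deriv, complexMGF,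
    integral_withDensity_eq_integral_smul (by fun_prop)]
  refine integral_congr_ae ?_
  filter_upwards [h.pos] with r hr
  rw [NNReal.smul_def, Real.coe_toNNReal _ (by positivity), Complex.real_smul, add_mul,
    Complex.exp_add]
  push_cast
  rw [id, one_mul]
  have : Complex.exp (-(r : ℂ)) * Complex.exp r = 1 := by rw [← Complex.exp_add]; simp
  linear_combination (r : ℂ) * Complex.exp (w * r) * (-this)

lemma zero_mem_interior_integrableExpSet : (0 : ℝ) ∈ interior (integrableExpSet id
    (ν.withDensity fun r => ((r * Real.exp (-r)).toNNReal : ℝ≥0∞))) := by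
  rw [mem_interior]
  refine ⟨Iio 1, fun t ht => ?_, isOpen_Iio, by simp⟩
  have ht' : 0 < 1 - t := by simpa using ht
  change Integrable (fun r : ℝ => Real.exp (t * id r)) _
  rw [integrable_withDensity_iff_integrable_smul (by fun_prop)]
  refine (h.integrable.const_mul (max 1 (1 - t)⁻¹)).mono' (by fun_prop) ?_
  filter_upwards [h.pos] with r hr
  rw [NNReal.smul_def, Real.coe_toNNReal _ (by positivity), smul_eq_mul,
    Real.norm_of_nonneg (by positivity), mul_assoc, ← Real.exp_add]
  convert mul_exp_neg_mul_le ht' hr using 3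
  simp only [id]; ring

lemma iteratedDeriv_deriv_levyExponent (n : ℕ) :
    iteratedDeriv n (deriv (levyExponent ν)) (-1) = tiltedMoment ν (n + 1) := by
  have h1 : deriv (levyExponent ν) =ᶠ[𝓝 (-1)] fun w => complexMGF id
      (ν.withDensity fun r => ((r * Real.exp (-r)).toNNReal : ℝ≥0∞)) (w + 1) := by
    have : ∀ᶠ w : ℂ in 𝓝 (-1), w.re < 0 :=
      (isOpen_lt Complex.continuous_re continuous_const).mem_nhds (by simp)
    filter_upwards [this] with w hw using h.deriv_levyExponent hw
  rw [h1.iteratedDeriv_eq, iteratedDeriv_comp_add_const]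
  beta_reduce
  rw [neg_add_cancel, iteratedDeriv_complexMGF h.zero_mem_interior_integrableExpSet,
    integral_withDensity_eq_integral_smul (by fun_prop), tiltedMoment, ← integral_complex_ofReal]
  refine integral_congr_ae ?_
  filter_upwards [h.pos] with r hr
  rw [NNReal.smul_def, Real.coe_toNNReal _ (by positivity), Complex.real_smul]
  push_cast
  simp only [id, zero_mul, Complex.exp_zero, mul_one]
  ring

end IsSubordinatorMeasure

/-! ### Recurrence for the tilted moments of an infinitely divisible variable. -/

section Moments

variable {S : Type*} [MeasurableSpace S] {P : Measure S} [IsProbabilityMeasure P]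
  {X : S → ℝ} {ν : Measure ℝ} {a : ℝ}

theorem integral_exp_neg_eq (hX : Measurable X) (hX0 : ∀ s, 0 ≤ X s)
    (hν : IsSubordinatorMeasure ν) (ha : 0 ≤ a)
    (hchar : ∀ u : ℝ, complexMGF X P (u * Complex.I) =
      Complex.exp (a * levyExponent ν (u * Complex.I))) :
    ∫ s, Real.exp (-X s) ∂P = Real.exp (a * ∫ r, (Real.exp (-r) - 1) ∂ν) := by
  have := complexMGF_eq_exp_levyExponent hX hX0 hν ha hchar (w := -1) (by simp)
  apply Complex.ofReal_injective
  rw [← integral_complex_ofReal]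
  push_cast
  rw [← integral_complex_ofReal]
  push_cast
  simpa [complexMGF, levyExponent] using this

/-- The transform $F=e^{a\psi}$ satisfies $F'=a\psi'F$; Leibniz' rule for the $n$-th derivative at
$-1$ is the recurrence. -/
theorem integral_pow_mul_exp_neg_succ (hX : Measurable X) (hX0 : ∀ s, 0 ≤ X s)
    (hν : IsSubordinatorMeasure ν) (ha : 0 ≤ a)
    (hchar : ∀ u : ℝ, complexMGF X P (u * Complex.I) =
      Complex.exp (a * levyExponent ν (u * Complex.I))) (n : ℕ) :
    ∫ s, X s ^ (n + 1) * Real.exp (-X s) ∂P =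
      a * ∑ i ∈ Finset.range (n + 1), (n.choose i : ℝ) * tiltedMoment ν (i + 1) *
        ∫ s, X s ^ (n - i) * Real.exp (-X s) ∂P := by
  have hint : (-1 : ℂ).re ∈ interior (integrableExpSet X P) :=
    interior_integrableExpSet_of_nonneg hX hX0 (by simp)
  have hmom : ∀ k, iteratedDeriv k (complexMGF X P) (-1) =
      ((∫ s, X s ^ k * Real.exp (-X s) ∂P : ℝ) : ℂ) := fun k => by
    rw [iteratedDeriv_complexMGF hint, ← integral_complex_ofReal]
    push_cast
    simp
  have hneg : ∀ᶠ w : ℂ in 𝓝 (-1), w.re < 0 :=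
    (isOpen_lt Complex.continuous_re continuous_const).mem_nhds (by simp)
  have hderiv : deriv (complexMGF X P) =ᶠ[𝓝 (-1)]
      fun w => (a : ℂ) * (deriv (levyExponent ν) * complexMGF X P) w := by
    filter_upwards [hneg] with w hw
    have h1 : complexMGF X P =ᶠ[𝓝 w] fun w => Complex.exp (a * levyExponent ν w) := by
      filter_upwards [(isOpen_lt Complex.continuous_re continuous_const).mem_nhds hw] with v hv
      exact complexMGF_eq_exp_levyExponent hX hX0 hν ha hchar (le_of_lt hv)
    rw [h1.deriv_eq, Pi.mul_apply, h1.eq_of_nhds,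
      ((hν.hasDerivAt_levyExponent hw).const_mul (a : ℂ)).cexp.deriv,
      (hν.hasDerivAt_levyExponent hw).deriv]
    ring
  have hdiff : DifferentiableOn ℂ (levyExponent ν) {w | w.re < 0} := fun w hw =>
    (hν.hasDerivAt_levyExponent hw).differentiableAt.differentiableWithinAt
  have han : AnalyticAt ℂ (levyExponent ν) (-1) :=
    hdiff.analyticAt ((isOpen_lt Complex.continuous_re continuous_const).mem_nhds (by simp))
  apply Complex.ofReal_injective
  rw [← hmom, iteratedDeriv_succ', hderiv.iteratedDeriv_eq, iteratedDeriv_const_mul_field,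
    iteratedDeriv_mul han.deriv.contDiffAt (analyticAt_complexMGF hint).contDiffAt]
  push_cast
  simp only [hν.iteratedDeriv_deriv_levyExponent, hmom]

end Moments

/-- First-order expansion in `a` of a sequence of polynomials of binomial type. -/
lemma exists_abs_sub_le_sq_of_recurrence (κ : ℕ → ℝ) (c : ℝ) (n : ℕ) :
    ∃ C, 0 ≤ C ∧ ∀ a, 0 ≤ a → a ≤ c → ∀ h : ℕ → ℝ, h 0 = 1 →
      (∀ n, h (n + 1) = a * ∑ i ∈ Finset.range (n + 1), (n.choose i : ℝ) * κ (i + 1) * h (n - i)) →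
      |h (n + 1) - a * κ (n + 1)| ≤ C * a ^ 2 := by
  induction n using Nat.strong_induction_on with
  | _ n ih =>
    choose! C hC0 hC using ih
    -- Every term with `i < n` contains `h (n - i)` of positive index, which by induction is $O(a)$;
    -- the outer factor `a` makes it $O(a^2)$. `n - i - 1 + 1` is `n - i` in successor form, and
    -- `|c|` absorbs one power of `a`.
    refine ⟨∑ i ∈ Finset.range n, |(n.choose i : ℝ) * κ (i + 1)| *
      (|κ (n - i - 1 + 1)| + C (n - i - 1) * |c|), ?_, fun a ha hac h h0 hrec => ?_⟩
    · refine Finset.sum_nonneg fun i hi => ?_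
      have := hC0 (n - i - 1) (by have := Finset.mem_range.1 hi; omega)
      positivity
    · rw [hrec, Finset.sum_range_succ]
      -- The term `i = n` carries `h 0 = 1` and is the whole first-order part.
      have hlast : (n.choose n : ℝ) * κ (n + 1) * h (n - n) = κ (n + 1) := by simp [h0]
      rw [hlast, mul_add, add_sub_cancel_right, abs_mul, abs_of_nonneg ha, Finset.sum_mul]
      calc a * |∑ i ∈ Finset.range n, (n.choose i : ℝ) * κ (i + 1) * h (n - i)|
          ≤ a * ∑ i ∈ Finset.range n, |(n.choose i : ℝ) * κ (i + 1) * h (n - i)| := by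
            gcongr
            exact Finset.abs_sum_le_sum_abs _ _
        _ = ∑ i ∈ Finset.range n, a * |(n.choose i : ℝ) * κ (i + 1) * h (n - i)| :=
            Finset.mul_sum _ _ _
        _ ≤ _ := by
            refine Finset.sum_le_sum fun i hi => ?_
            have hi' := Finset.mem_range.1 hi
            have hlt : n - i - 1 < n := by omega
            have h1 := hC (n - i - 1) hlt a ha hac h h0 hrec
            have h2 := hC0 (n - i - 1) hlt
            have h3 : n - i = n - i - 1 + 1 := by omega
            rw [abs_mul]
            have h4 : |h (n - i)| ≤ (|κ (n - i - 1 + 1)| + C (n - i - 1) * |c|) * a := by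
              have h5 : |h (n - i - 1 + 1)| ≤ |h (n - i - 1 + 1) - a * κ (n - i - 1 + 1)| +
                  |a * κ (n - i - 1 + 1)| := by
                simpa using abs_add_le (h (n - i - 1 + 1) - a * κ (n - i - 1 + 1))
                  (a * κ (n - i - 1 + 1))
              rw [abs_mul, abs_of_nonneg ha] at h5
              have h6 : C (n - i - 1) * a ^ 2 ≤ C (n - i - 1) * |c| * a := by
                rw [sq, ← mul_assoc]
                have := hac.trans (le_abs_self c)
                gcongr
              rw [← h3] at h5 h1 ⊢
              linarith
            calc a * (|(n.choose i : ℝ) * κ (i + 1)| * |h (n - i)|)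
                ≤ a * (|(n.choose i : ℝ) * κ (i + 1)| *
                  ((|κ (n - i - 1 + 1)| + C (n - i - 1) * |c|) * a)) := by gcongr
              _ = _ := by ring

/-! ### Moments of a completely random measure over disjoint sets. -/

section CRM

variable {S Ω : Type*} [MeasurableSpace S] [MeasurableSpace Ω] {P : Measure S}
  {ρ : Measure ℝ} {G₀ : Measure Ω} {G : S → Measure Ω}

/-- `∫₀^∞ (e^{-r} - 1) ρ(dr)`. -/
def laplaceRate (ρ : Measure ℝ) : ℝ := ∫ r in Ioi (0 : ℝ), (Real.exp (-r) - 1) ∂ρ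

/-- `E[G(A)ⁿ e^{-G(A)}] / E[e^{-G(A)}]`. -/
def normalizedMoment (P : Measure S) (ρ : Measure ℝ) (G₀ : Measure Ω) (G : S → Measure Ω)
    (A : Set Ω) (n : ℕ) : ℝ :=
  Real.exp (-(G₀.real A * laplaceRate ρ)) *
    ∫ s, (G s).real A ^ n * Real.exp (-(G s).real A) ∂P

lemma normalizedMoment_nonneg (A : Set Ω) (n : ℕ) : 0 ≤ normalizedMoment P ρ G₀ G A n := by
  refine mul_nonneg (Real.exp_pos _).le (integral_nonneg fun s => ?_)
  simp only [Pi.zero_apply]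
  positivity

lemma tiltedMoment_restrict (n : ℕ) : tiltedMoment (ρ.restrict (Ioi 0)) n = kappa ρ n := rfl

lemma IsCompletelyRandomMeasure.measurable_real {ν : Measure (ℝ × Ω)}
    (hG : IsCompletelyRandomMeasure P G ν) {A : Set Ω} (hA : MeasurableSet A) :
    Measurable fun s => (G s).real A :=
  ((Measure.measurable_coe hA).comp hG.measurable).ennreal_toReal

variable [IsFiniteMeasure G₀]
  (hρ : IsSubordinatorMeasure (ρ.restrict (Ioi 0)))
  (hG : IsCompletelyRandomMeasure P G (levyMeasure ρ G₀))

include hρ hG in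
lemma complexMGF_real_eq {A : Set Ω} (hA : MeasurableSet A) (u : ℝ) :
    complexMGF (fun s => (G s).real A) P (u * Complex.I) =
      Complex.exp ((G₀.real A : ℝ) * levyExponent (ρ.restrict (Ioi 0)) (u * Complex.I)) := by
  have := hρ.sFinite
  have h1 := hG.charFun_eq A hA u
  rw [complexMGF]
  have h2 : (levyMeasure ρ G₀).restrict (univ ×ˢ A) =
      (ρ.restrict (Ioi 0)).prod (G₀.restrict A) := by
    rw [levyMeasure, ← Measure.prod_restrict, Measure.restrict_univ]
  rw [h2, integral_fun_fst (fun r : ℝ => Complex.exp (Complex.I * (u : ℂ) * (r : ℂ)) - 1)] at h1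
  have h3 : (G₀.restrict A).real univ = G₀.real A := by simp
  rw [h3, Complex.real_smul] at h1
  simp only [levyExponent, mul_comm (u : ℂ) Complex.I]
  exact h1

/-- The joint tilted moments of a completely random measure over a finite partition factor. -/
theorem integral_exp_neg_mul_prod_pow
    (hG : IsCompletelyRandomMeasure P G (levyMeasure ρ G₀)) {ι : Type*} [Fintype ι] {A : ι → Set Ω}
    (hA : ∀ i, MeasurableSet (A i)) (hdisj : Pairwise (Function.onFun Disjoint A))
    (hunion : ⋃ i, A i = univ) (n : ι → ℕ) :
    ∫ s, Real.exp (-(G s).real univ) * ∏ i, (G s).real (A i) ^ n i ∂P =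
      Real.exp (G₀.real univ * laplaceRate ρ) *
        ∏ i, normalizedMoment P ρ G₀ G (A i) (n i) := by
  have hind : iIndepFun (fun i s => (G s).real (A i) ^ n i * Real.exp (-(G s).real (A i))) P := by
    let e := Fintype.equivFin ι
    have h1 := hG.indep (Fintype.card ι) (fun k => A (e.symm k)) (fun k => hA _)
      (fun j k hjk => hdisj (e.symm.injective.ne hjk))
    have h2 := h1.precomp e.injective
    simp only [Equiv.symm_apply_apply] at h2
    exact h2.comp (fun i x => x.toReal ^ n i * Real.exp (-x.toReal)) (fun i => by fun_prop)
  -- Where $G(\Omega)$ is finite, $e^{-G(\Omega)}$ splits over the cells, and the integrand becomes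
  -- a product of functions of independent masses.
  have h3 : ∫ s, Real.exp (-(G s).real univ) * ∏ i, (G s).real (A i) ^ n i ∂P =
      ∫ s, ∏ i, (G s).real (A i) ^ n i * Real.exp (-(G s).real (A i)) ∂P := by
    refine integral_congr_ae ?_
    filter_upwards [hG.finite] with s hs
    have : IsFiniteMeasure (G s) := ⟨hs⟩
    rw [Finset.prod_mul_distrib, ← Real.exp_sum, Finset.sum_neg_distrib, ← hunion,
      measureReal_iUnion_fintype hdisj hA, mul_comm]
  rw [h3, hind.integral_fun_prod_eq_prod_integral]
  · simp only [normalizedMoment]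
    rw [Finset.prod_mul_distrib, ← Real.exp_sum, ← mul_assoc, ← Real.exp_add,
      Finset.sum_neg_distrib, ← Finset.sum_mul, ← measureReal_iUnion_fintype hdisj hA, hunion]
    simp
  · intro i
    exact (((hG.measurable_real (hA i)).pow_const _).mul
      (hG.measurable_real (hA i)).neg.exp).aestronglyMeasurable

variable [IsProbabilityMeasure P]

include hρ hG

lemma normalizedMoment_zero {A : Set Ω} (hA : MeasurableSet A) :
    normalizedMoment P ρ G₀ G A 0 = 1 := by
  rw [normalizedMoment]
  simp only [pow_zero, one_mul]
  rw [integral_exp_neg_eq (hG.measurable_real hA) (fun s => measureReal_nonneg) hρ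
    measureReal_nonneg (complexMGF_real_eq hρ hG hA), laplaceRate, ← Real.exp_add]
  simp

lemma normalizedMoment_succ {A : Set Ω} (hA : MeasurableSet A) (n : ℕ) :
    normalizedMoment P ρ G₀ G A (n + 1) = G₀.real A * ∑ i ∈ Finset.range (n + 1),
      (n.choose i : ℝ) * kappa ρ (i + 1) * normalizedMoment P ρ G₀ G A (n - i) := by
  rw [normalizedMoment, integral_pow_mul_exp_neg_succ (hG.measurable_real hA)
    (fun s => measureReal_nonneg) hρ measureReal_nonneg (complexMGF_real_eq hρ hG hA),
    Finset.mul_sum, Finset.mul_sum, Finset.mul_sum]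
  refine Finset.sum_congr rfl fun i _ => ?_
  rw [tiltedMoment_restrict, normalizedMoment]
  ring

/-- The constant is uniform in `A`: the recurrence depends on `A` only through its mass, which is at
most the total mass. -/
lemma exists_abs_normalizedMoment_sub_le (n : ℕ) :
    ∃ C, 0 ≤ C ∧ ∀ A : Set Ω, MeasurableSet A →
      |normalizedMoment P ρ G₀ G A (n + 1) - G₀.real A * kappa ρ (n + 1)| ≤
        C * G₀.real A ^ 2 := by
  obtain ⟨C, hC0, hC⟩ := exists_abs_sub_le_sq_of_recurrence (kappa ρ) (G₀.real univ) n
  exact ⟨C, hC0, fun A hA => hC _ measureReal_nonneg (measureReal_mono (subset_univ A)) _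
    (normalizedMoment_zero hρ hG hA) (normalizedMoment_succ hρ hG hA)⟩

end CRM

/-! ### Sums over injective tuples. -/

/-- Sums of products over injective tuples of indices. -/
def injSum {ι : Type*} [Fintype ι] {l : ℕ} (h : Fin l → ι → ℝ) : ℝ :=
  open Classical in ∑ c : Fin l → ι, if Function.Injective c then ∏ j, h j (c j) else 0

/-- Dropping injectivity for the first index adds only the values already taken by the other `l`
indices, each of weight at most `ε`. -/
lemma abs_injSum_succ_sub_le {ι : Type*} [Fintype ι] {l : ℕ} (h : Fin (l + 1) → ι → ℝ)
    (h0 : ∀ j x, 0 ≤ h j x) {ε : ℝ} (hε : ∀ x, h 0 x ≤ ε) :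
    |injSum h - (∑ x, h 0 x) * injSum (fun j => h j.succ)| ≤
      (l * ε) * injSum (fun j => h j.succ) := by
  classical
  have h1 : injSum h = ∑ c : Fin l → ι, if Function.Injective c then
      (∑ x, if x ∉ range c then h 0 x else 0) * ∏ j, h j.succ (c j) else 0 := by
    rw [injSum, ← (Fin.consEquiv fun _ => ι).sum_comp, Fintype.sum_prod_type, Finset.sum_comm]
    refine Finset.sum_congr rfl fun c _ => ?_
    by_cases hc : Function.Injective c
    · rw [if_pos hc, Finset.sum_mul]
      refine Finset.sum_congr rfl fun x _ => ?_
      simp [Fin.consEquiv, Fin.cons_injective_iff, hc, Fin.prod_univ_succ]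
    · simp [Fin.consEquiv, Fin.cons_injective_iff, hc]
  have h2 : injSum h - (∑ x, h 0 x) * injSum (fun j => h j.succ) =
      -∑ c : Fin l → ι, if Function.Injective c then
        (∑ x, if x ∈ range c then h 0 x else 0) * ∏ j, h j.succ (c j) else 0 := by
    rw [h1, injSum, Finset.mul_sum, ← Finset.sum_sub_distrib, ← Finset.sum_neg_distrib]
    refine Finset.sum_congr rfl fun c _ => ?_
    split_ifs
    · rw [← sub_mul, ← Finset.sum_sub_distrib, ← neg_mul, ← Finset.sum_neg_distrib]
      congr 1
      refine Finset.sum_congr rfl fun x _ => ?_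
      by_cases hx : x ∈ range c <;> simp [hx]
    · simp
  rw [h2, abs_neg, abs_of_nonneg, injSum, Finset.mul_sum]
  · refine Finset.sum_le_sum fun c _ => ?_
    split_ifs with hc
    · refine mul_le_mul_of_nonneg_right ?_ (Finset.prod_nonneg fun j _ => h0 _ _)
      rw [← Finset.sum_filter]
      have h3 : Finset.univ.filter (fun x => x ∈ range c) = Finset.univ.image c := by
        ext x; simp
      rw [h3, Finset.sum_image fun i _ j _ hij => hc hij]
      refine (Finset.sum_le_sum fun j _ => hε (c j)).trans ?_
      simp
    · simp
  · refine Finset.sum_nonneg fun c _ => ?_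
    split_ifs
    · refine mul_nonneg (Finset.sum_nonneg fun x _ => ?_) (Finset.prod_nonneg fun j _ => h0 _ _)
      split_ifs
      · exact h0 _ _
      · exact le_rfl
    · exact le_rfl

/-- If the entries are uniformly small, sums over injective tuples behave like products of sums. -/
theorem tendsto_injSum {ι : ℕ → Type*} [∀ N, Fintype (ι N)] {l : ℕ}
    (h : ∀ N, Fin l → ι N → ℝ) (h0 : ∀ N j x, 0 ≤ h N j x) (b : Fin l → ℝ)
    (hb : ∀ j, Tendsto (fun N => ∑ x, h N j x) atTop (𝓝 (b j)))
    (ε : ℕ → ℝ) (hε : ∀ N j x, h N j x ≤ ε N) (hε0 : Tendsto ε atTop (𝓝 0)) :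
    Tendsto (fun N => injSum (h N)) atTop (𝓝 (∏ j, b j)) := by
  induction l with
  | zero => simp [injSum, Function.injective_of_subsingleton]
  | succ l ih =>
    have h1 := ih (fun N j => h N j.succ) (fun N j x => h0 N _ x) (fun j => b j.succ)
      (fun j => hb _) (fun N j x => hε N _ x)
    have h2 := (hb 0).mul h1
    have h3 := (hε0.const_mul (l : ℝ)).mul h1
    simp only [mul_zero, zero_mul] at h3
    have h4 := squeeze_zero_norm (fun N => (Real.norm_eq_abs _).trans_le <|
      abs_injSum_succ_sub_le (h N) (h0 N) (hε N 0)) h3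
    have h5 := h4.add h2
    rw [Fin.prod_univ_succ]
    simpa using h5

/-! ### Refining partitions and the limit over cells. -/

section Partition

variable {Ω : Type*} [MeasurableSpace Ω]

/-- A sequence of finite measurable partitions, given by the index of the cell of each point, that
eventually separates any two distinct points. -/
structure IsSeparatingSequence {ι : ℕ → Type*} [∀ N, MeasurableSpace (ι N)]
    (φ : ∀ N, Ω → ι N) : Prop where
  measurable : ∀ N, Measurable (φ N)
  separates : ∀ x y, x ≠ y → ∀ᶠ N in atTop, φ N x ≠ φ N y

open Classical in
-- The cell of a point at stage `N` records its membership in the first `N` sets of a separating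
-- sequence.
lemma exists_isSeparatingSequence (Ω : Type*) [MeasurableSpace Ω]
    [MeasurableSpace.CountablySeparated Ω] :
    ∃ φ : ∀ N : ℕ, Ω → (Fin N → Bool), IsSeparatingSequence φ := by
  obtain ⟨e, he, hsep⟩ := exists_seq_separating Ω (p := MeasurableSet) MeasurableSet.empty univ
  refine ⟨fun N x i => decide (x ∈ e i), ⟨fun N => ?_, fun x y hxy => ?_⟩⟩
  · refine measurable_pi_lambda _ fun i => ?_
    refine measurable_to_bool ?_
    convert he i
    ext x
    simp
  · have : ∃ n, ¬ (x ∈ e n ↔ y ∈ e n) := by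
      by_contra! hcon
      exact hxy (hsep x (mem_univ _) y (mem_univ _) hcon)
    obtain ⟨n, hn⟩ := this
    filter_upwards [eventually_gt_atTop n] with N hN heq
    refine hn ?_
    simpa using congrFun heq ⟨n, hN⟩

variable {ι : ℕ → Type*} [∀ N, Fintype (ι N)] [∀ N, MeasurableSpace (ι N)]
  [∀ N, MeasurableSingletonClass (ι N)] {φ : ∀ N, Ω → ι N}

/-- The sum is the $G_0\otimes G_0$ measure of the pairs lying in a common cell. These sets converge
pointwise to the diagonal, which is null because $G_0$ charges no point. -/
lemma IsSeparatingSequence.tendsto_sum_sq (hφ : IsSeparatingSequence φ) (G₀ : Measure Ω)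
    [IsFiniteMeasure G₀] [NullSingletonClass G₀] :
    Tendsto (fun N => ∑ c, G₀.real (φ N ⁻¹' {c}) ^ 2) atTop (𝓝 0) := by
  have hm : ∀ N c, MeasurableSet (φ N ⁻¹' {c}) := fun N c =>
    hφ.measurable N (measurableSet_singleton c)
  set B : ℕ → Set (Ω × Ω) := fun N => {p | φ N p.1 = φ N p.2} with hB
  have hBu : ∀ N, B N = ⋃ c, (φ N ⁻¹' {c}) ×ˢ (φ N ⁻¹' {c}) := fun N => by
    ext p
    simp [hB, eq_comm]
  have hBm : ∀ N, MeasurableSet (B N) := fun N => by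
    rw [hBu]
    exact MeasurableSet.iUnion fun c => (hm N c).prod (hm N c)
  have hBd : ∀ N, (G₀.prod G₀).real (B N) = ∑ c, G₀.real (φ N ⁻¹' {c}) ^ 2 := fun N => by
    rw [hBu, measureReal_iUnion_fintype _ fun c => (hm N c).prod (hm N c)]
    · simp [measureReal_prod_prod, sq]
    · intro c d hcd
      refine disjoint_left.2 fun p hp hq => hcd ?_
      simp only [mem_prod, mem_preimage, mem_singleton_iff] at hp hq
      exact hp.1.symm.trans hq.1
  have hlim : ∀ p : Ω × Ω, ∀ᶠ N in atTop, (p ∈ B N ↔ p ∈ diagonal Ω) := fun p => by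
    by_cases hp : p.1 = p.2
    · exact Eventually.of_forall fun N => by simp [hB, hp]
    · filter_upwards [hφ.separates _ _ hp] with N hN
      simp [hB, hp, hN]
  have hdm : MeasurableSet (diagonal Ω) := by
    -- Measurability of the diagonal comes from its being the limsup of the measurable sets `B k`.
    have : diagonal Ω = ⋂ N, ⋃ k ≥ N, B k := by
      ext p
      simp only [mem_iInter, mem_iUnion]
      constructor
      · intro hp N
        exact ⟨N, le_rfl, by simpa [hB] using congrArg (φ N) (mem_diagonal_iff.1 hp)⟩
      · intro hp
        obtain ⟨N, hN⟩ := eventually_atTop.1 (hlim p)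
        obtain ⟨k, hk, hkB⟩ := hp N
        exact (hN k hk).1 hkB
    rw [this]
    exact MeasurableSet.iInter fun N => MeasurableSet.iUnion fun k =>
      MeasurableSet.iUnion fun _ => hBm k
  have hd0 : (G₀.prod G₀) (diagonal Ω) = 0 := by
    rw [Measure.measure_prod_null hdm]
    refine ae_of_all _ fun x => ?_
    have : Prod.mk x ⁻¹' diagonal Ω = {x} := by
      ext y; simp [eq_comm]
    simp [this]
  have h1 := tendsto_measure_of_tendsto_indicator_of_isFiniteMeasure atTop (G₀.prod G₀) hBm hlim
  rw [hd0] at h1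
  have h2 := (ENNReal.tendsto_toReal ENNReal.zero_ne_top).comp h1
  refine h2.congr fun N => ?_
  rw [← hBd]
  rfl

variable {S : Type*} [MeasurableSpace S] {P : Measure S} [IsProbabilityMeasure P]
  {ρ : Measure ℝ} {G₀ : Measure Ω} [IsFiniteMeasure G₀] [NullSingletonClass G₀]
  {G : S → Measure Ω}

theorem IsSeparatingSequence.tendsto_injSum_normalizedMoment (hφ : IsSeparatingSequence φ)
    (hρ : IsSubordinatorMeasure (ρ.restrict (Ioi 0)))
    (hG : IsCompletelyRandomMeasure P G (levyMeasure ρ G₀))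
    {l : ℕ} (n : Fin l → ℕ) (hn : ∀ j, 1 ≤ n j) :
    Tendsto (fun N => injSum fun j c => normalizedMoment P ρ G₀ G (φ N ⁻¹' {c}) (n j))
      atTop (𝓝 (∏ j, G₀.real univ * kappa ρ (n j))) := by
  have hm : ∀ N c, MeasurableSet (φ N ⁻¹' {c}) := fun N c =>
    hφ.measurable N (measurableSet_singleton c)
  have hex : ∀ j, ∃ C, 0 ≤ C ∧ ∀ A : Set Ω, MeasurableSet A →
      |normalizedMoment P ρ G₀ G A (n j) - G₀.real A * kappa ρ (n j)| ≤ C * G₀.real A ^ 2 :=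
    fun j => by
      have := exists_abs_normalizedMoment_sub_le hρ hG (n j - 1)
      rwa [Nat.sub_add_cancel (hn j)] at this
  choose C hC0 hC using hex
  have hκ : ∀ k, 0 ≤ kappa ρ k := fun k => hρ.tiltedMoment_nonneg k
  have hσ := hφ.tendsto_sum_sq G₀
  set σ : ℕ → ℝ := fun N => ∑ c, G₀.real (φ N ⁻¹' {c}) ^ 2 with hσdef
  have hle : ∀ N c, G₀.real (φ N ⁻¹' {c}) ^ 2 ≤ σ N := fun N c =>
    Finset.single_le_sum (f := fun c => G₀.real (φ N ⁻¹' {c}) ^ 2) (fun c _ => sq_nonneg _)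
      (Finset.mem_univ c)
  have hsum : ∀ N, ∑ c, G₀.real (φ N ⁻¹' {c}) = G₀.real univ := fun N => by
    rw [← measureReal_iUnion_fintype _ (hm N), ← preimage_iUnion, iUnion_of_singleton,
      preimage_univ]
    exact fun c d hcd => Disjoint.preimage _ (by simpa using hcd)
  refine tendsto_injSum _ (fun N j c => normalizedMoment_nonneg _ _) _ (fun j => ?_)
    -- Each cell has mass at most `√(σ N)`; summing over `j` makes the bound independent of the
    -- block.
    (fun N => ∑ j, (√(σ N) * kappa ρ (n j) + C j * σ N)) (fun N j c => ?_) ?_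
  · have h1 : Tendsto (fun N => ∑ c, normalizedMoment P ρ G₀ G (φ N ⁻¹' {c}) (n j) -
        G₀.real univ * kappa ρ (n j)) atTop (𝓝 0) := by
      refine squeeze_zero_norm (fun N => ?_) (by simpa using hσ.const_mul (C j))
      rw [Real.norm_eq_abs, ← hsum N, Finset.sum_mul, ← Finset.sum_sub_distrib]
      refine (Finset.abs_sum_le_sum_abs _ _).trans ?_
      rw [hσdef, Finset.mul_sum]
      exact Finset.sum_le_sum fun c _ => hC j _ (hm N c)
    simpa using h1.add_const (G₀.real univ * kappa ρ (n j))
  · refine le_trans ?_ (Finset.single_le_sum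
      (f := fun j => √(σ N) * kappa ρ (n j) + C j * σ N) (fun j _ => ?_) (Finset.mem_univ j))
    · have h1 := (abs_le.1 (hC j _ (hm N c))).2
      have h2 : G₀.real (φ N ⁻¹' {c}) ≤ √(σ N) := Real.le_sqrt_of_sq_le (hle N c)
      have h3 := mul_le_mul_of_nonneg_right h2 (hκ (n j))
      have h4 := mul_le_mul_of_nonneg_left (hle N c) (hC0 j)
      linarith
    · have h1 := mul_nonneg (Real.sqrt_nonneg (σ N)) (hκ (n j))
      have h2 := mul_nonneg (hC0 j) (Finset.sum_nonneg fun c _ => sq_nonneg _ : 0 ≤ σ N)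
      exact add_nonneg h1 h2
  · have h1 : Tendsto (fun N => √(σ N)) atTop (𝓝 0) := by
      simpa [Function.comp_def] using (Real.continuous_sqrt.tendsto 0).comp hσ
    have h2 := tendsto_finsetSum Finset.univ fun j _ =>
      (h1.mul_const (kappa ρ (n j))).add (hσ.const_mul (C j))
    simpa using h2

end Partition

lemma tsum_prod_eq_prod_tsum {m : ℕ} (f : Fin m → ℕ → ℝ≥0∞) :
    ∑' k : Fin m → ℕ, ∏ i, f i (k i) = ∏ i, ∑' k, f i k := by
  induction m with
  | zero => simp
  | succ m ih =>
    rw [← (Fin.consEquiv fun _ => ℕ).tsum_eq, ENNReal.tsum_prod', Fin.prod_univ_succ, ← ih,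
      ← ENNReal.tsum_mul_right]
    refine tsum_congr fun a => ?_
    rw [← ENNReal.tsum_mul_left]
    refine tsum_congr fun k => ?_
    simp [Fin.consEquiv, Fin.prod_univ_succ]

/-! ### The joint law of the sample size and the sampled atoms. -/

section Sample

variable {S Ω : Type*} [MeasurableSpace Ω] {r : ℕ → S → ℝ≥0} {loc : ℕ → S → Ω}

lemma atomicMeasure_apply {A : Set Ω} (hA : MeasurableSet A) (s : S) :
    atomicMeasure r loc s A = ∑' k, (r k s : ℝ≥0∞) * A.indicator 1 (loc k s) := by
  rw [atomicMeasure, Measure.sum_apply _ hA]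
  exact tsum_congr fun k => by rw [Measure.smul_apply, Measure.dirac_apply' _ hA, smul_eq_mul]

lemma le_atomicMeasure_univ (k : ℕ) (s : S) : (r k s : ℝ≥0∞) ≤ atomicMeasure r loc s univ := by
  rw [atomicMeasure_apply MeasurableSet.univ]
  simpa using ENNReal.le_tsum (f := fun k => (r k s : ℝ≥0∞)) k

lemma poissonMeasure_mul_prod_div {s : S} (hs : atomicMeasure r loc s univ < ∞) {m : ℕ}
    (k : Fin m → ℕ) :
    (poissonMeasure (atomicMeasure r loc s univ).toNNReal).real {m} *
        ∏ i, (r (k i) s : ℝ) / (atomicMeasure r loc s univ).toReal =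
      (m.factorial : ℝ)⁻¹ * Real.exp (-(atomicMeasure r loc s univ).toReal) *
        ∏ i, (r (k i) s : ℝ) := by
  rw [poissonMeasure_real_singleton, ENNReal.coe_toNNReal_eq_toReal, Finset.prod_div_distrib,
    Finset.prod_const, Finset.card_univ, Fintype.card_fin]
  -- At total mass 0 the quotients take the default value 0; all weights vanish too, so both sides
  -- agree.
  rcases eq_or_ne (atomicMeasure r loc s univ) 0 with h0 | h0
  · rcases m with _ | m
    · simp
    · have h1 : r (k 0) s = 0 := by
        have := le_atomicMeasure_univ (r := r) (loc := loc) (k 0) s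
        rw [h0] at this
        simpa using this
      simp [Fin.prod_univ_succ, h1]
  · have h1 : (atomicMeasure r loc s univ).toReal ≠ 0 := ENNReal.toReal_ne_zero.2 ⟨h0, hs.ne⟩
    field_simp

variable [MeasurableSpace S] {P : Measure S} [IsProbabilityMeasure P] {ρ : Measure ℝ}
  {G₀ : Measure Ω} {M : S → ℕ} {Z : ℕ → S → ℕ}
  (hmodel : IsCountMixture P ρ G₀ r loc M Z)
include hmodel

/-- The joint law of the sample size, the indicators and the atoms. -/
lemma measure_sample_inter_eq {m : ℕ} (k : Fin m → ℕ) {D : Set S}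
    (hD : MeasurableSet[MeasurableSpace.comap (fun s (k : ℕ) => (r k s, loc k s)) inferInstance]
      D) :
    P ({s | M s = m ∧ ∀ i : Fin m, Z i s = k i} ∩ D) =
      ∫⁻ s in D, ENNReal.ofReal ((m.factorial : ℝ)⁻¹ *
        Real.exp (-(atomicMeasure r loc s univ).toReal)) * ∏ i, (r (k i) s : ℝ≥0∞) ∂P := by
  have hm : MeasurableSpace.comap (fun s (k : ℕ) => (r k s, loc k s)) inferInstance ≤
      (inferInstance : MeasurableSpace S) := by
    refine Measurable.comap_le (measurable_pi_lambda _ fun k => ?_)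
    exact (hmodel.measurable_weight k).prodMk (hmodel.measurable_loc k)
  have hE : MeasurableSet {s | M s = m ∧ ∀ i : Fin m, Z i s = k i} := by
    refine (hmodel.measurable_size (measurableSet_singleton m)).inter ?_
    have : {s | ∀ i : Fin m, Z i s = k i} = ⋂ i : Fin m, Z i ⁻¹' {k i} := by
      ext s; simp
    change MeasurableSet {s | ∀ i : Fin m, Z i s = k i}
    rw [this]
    exact MeasurableSet.iInter fun i => hmodel.measurable_indicator i (measurableSet_singleton _)
  have hD' := hm _ hD
  have hint : Integrable (indicator {s | M s = m ∧ ∀ i : Fin m, Z i s = k i}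
      (fun _ => (1 : ℝ))) P := (integrable_const 1).indicator hE
  -- `D` is an event of the conditioning σ-algebra, so the conditional law may be integrated over
  -- it.
  have h1 := setIntegral_condExp hm hint hD
  rw [setIntegral_congr_ae hD' ((hmodel.sample m k).mono fun s hs _ => hs)] at h1
  have h2 : ∫ s in D, indicator {s | M s = m ∧ ∀ i : Fin m, Z i s = k i}
      (fun _ => (1 : ℝ)) s ∂P = P.real ({s | M s = m ∧ ∀ i : Fin m, Z i s = k i} ∩ D) := by
    rw [integral_indicator_const _ hE]
    simp [measureReal_restrict_apply hE]
  rw [h2] at h1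
  rw [← ofReal_measureReal, ← h1, ofReal_integral_eq_lintegral_ofReal]
  · refine setLIntegral_congr_fun_ae hD' ?_
    filter_upwards [hmodel.crm.finite] with s hs _
    rw [poissonMeasure_mul_prod_div hs, ENNReal.ofReal_mul (by positivity),
      ENNReal.ofReal_prod_of_nonneg fun i _ => NNReal.coe_nonneg _]
    simp
  · exact (integrable_condExp.congr (hmodel.sample m k)).integrableOn
  · exact ae_of_all _ fun s => mul_nonneg measureReal_nonneg
      (Finset.prod_nonneg fun i _ => by positivity)

/-- The sampled atoms almost surely have positive weight. -/
lemma ae_weight_ne_zero (m : ℕ) :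
    ∀ᵐ s ∂P, M s = m → ∀ i : Fin m, r (Z i s) s ≠ 0 := by
  have h1 : ∀ (k : Fin m → ℕ) (i : Fin m),
      P ({s | M s = m ∧ ∀ i : Fin m, Z i s = k i} ∩ {s | r (k i) s = 0}) = 0 := by
    intro k i
    have hD : MeasurableSet[MeasurableSpace.comap (fun s (k : ℕ) => (r k s, loc k s))
        inferInstance] {s | r (k i) s = 0} :=
      ⟨{x | (x (k i)).1 = 0},
        (measurable_fst.comp (measurable_pi_apply (k i))) (measurableSet_singleton 0), rfl⟩
    rw [measure_sample_inter_eq hmodel k hD]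
    have hD' : MeasurableSet {s | r (k i) s = 0} :=
      hmodel.measurable_weight (k i) (measurableSet_singleton 0)
    rw [setLIntegral_congr_fun hD' (g := fun _ => 0), lintegral_zero]
    intro s hs
    have hs' : r (k i) s = 0 := hs
    simp only
    rw [Finset.prod_eq_zero (Finset.mem_univ i) (by simp [hs']), mul_zero]
  rw [ae_iff]
  refine measure_mono_null ?_ (measure_iUnion_null fun k => measure_iUnion_null fun i => h1 k i)
  intro s hs
  simp only [mem_ofPred_eq, Classical.not_imp, not_forall, not_not] at hs
  obtain ⟨hM, i, hi⟩ := hs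
  simp only [mem_iUnion]
  exact ⟨fun i => Z i s, i, ⟨hM, fun _ => rfl⟩, hi⟩

/-- The joint law of the sample size and the sampled atoms. -/
theorem measureReal_sample_mem {m : ℕ} {A : Fin m → Set Ω} (hA : ∀ i, MeasurableSet (A i)) :
    P.real {s | M s = m ∧ ∀ i : Fin m, loc (Z i s) s ∈ A i} =
      (m.factorial : ℝ)⁻¹ * ∫ s, Real.exp (-(atomicMeasure r loc s).real univ) *
        ∏ i, (atomicMeasure r loc s).real (A i) ∂P := by
  have hZ : ∀ k : Fin m → ℕ, MeasurableSet {s | ∀ i : Fin m, Z i s = k i} := fun k => by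
    have : {s | ∀ i : Fin m, Z i s = k i} = ⋂ i : Fin m, Z i ⁻¹' {k i} := by
      ext s; simp
    rw [this]
    exact MeasurableSet.iInter fun i => hmodel.measurable_indicator i (measurableSet_singleton _)
  have hD : ∀ k : Fin m → ℕ, MeasurableSet[MeasurableSpace.comap
      (fun s (k : ℕ) => (r k s, loc k s)) inferInstance] {s | ∀ i, loc (k i) s ∈ A i} := fun k => by
    refine ⟨⋂ i, {x | (x (k i)).2 ∈ A i}, MeasurableSet.iInter fun i =>
      (measurable_snd.comp (measurable_pi_apply (k i))) (hA i), ?_⟩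
    ext s; simp
  have hD' : ∀ k : Fin m → ℕ, MeasurableSet {s | ∀ i, loc (k i) s ∈ A i} := fun k => by
    have : {s | ∀ i, loc (k i) s ∈ A i} = ⋂ i, loc (k i) ⁻¹' A i := by ext s; simp
    rw [this]
    exact MeasurableSet.iInter fun i => hmodel.measurable_loc _ (hA i)
  have hTm : Measurable fun s => (atomicMeasure r loc s univ).toReal :=
    hmodel.crm.measurable_real MeasurableSet.univ
  have hunion : {s | M s = m ∧ ∀ i : Fin m, loc (Z i s) s ∈ A i} = ⋃ k : Fin m → ℕ,
      ({s | M s = m ∧ ∀ i : Fin m, Z i s = k i} ∩ {s | ∀ i, loc (k i) s ∈ A i}) := by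
    ext s
    simp only [mem_ofPred_eq, mem_iUnion, mem_inter_iff]
    constructor
    · rintro ⟨hM, h⟩
      exact ⟨fun i => Z i s, ⟨hM, fun _ => rfl⟩, h⟩
    · rintro ⟨k, ⟨hM, hk⟩, h⟩
      exact ⟨hM, fun i => by rw [hk]; exact h i⟩
  have h1 : P {s | M s = m ∧ ∀ i : Fin m, loc (Z i s) s ∈ A i} =
      ∫⁻ s, ENNReal.ofReal ((m.factorial : ℝ)⁻¹ *
        Real.exp (-(atomicMeasure r loc s univ).toReal)) *
          ∏ i, atomicMeasure r loc s (A i) ∂P := by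
    rw [hunion, measure_iUnion]
    · rw [tsum_congr fun k => measure_sample_inter_eq hmodel k (hD k)]
      have h2 : ∀ k : Fin m → ℕ, ∫⁻ s in {s | ∀ i, loc (k i) s ∈ A i},
          ENNReal.ofReal ((m.factorial : ℝ)⁻¹ *
            Real.exp (-(atomicMeasure r loc s univ).toReal)) * ∏ i, (r (k i) s : ℝ≥0∞) ∂P =
          ∫⁻ s, ENNReal.ofReal ((m.factorial : ℝ)⁻¹ *
            Real.exp (-(atomicMeasure r loc s univ).toReal)) *
            ∏ i, ((r (k i) s : ℝ≥0∞) * (A i).indicator 1 (loc (k i) s)) ∂P := fun k => by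
        rw [← lintegral_indicator (hD' k)]
        refine lintegral_congr fun s => ?_
        by_cases hs : ∀ i, loc (k i) s ∈ A i
        · rw [indicator_of_mem (by exact hs)]
          congr 1
          exact Finset.prod_congr rfl fun i _ => by simp [hs i]
        · rw [indicator_of_notMem (by exact hs)]
          push Not at hs
          obtain ⟨i, hi⟩ := hs
          rw [Finset.prod_eq_zero (Finset.mem_univ i) (by simp [hi]), mul_zero]
      rw [tsum_congr h2, ← lintegral_tsum]
      · refine lintegral_congr fun s => ?_
        -- Summing over all indicator values turns products of atom weights into products of masses
        -- $G(A_i)$.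
        rw [ENNReal.tsum_mul_left,
          tsum_prod_eq_prod_tsum fun i k => (r k s : ℝ≥0∞) * (A i).indicator 1 (loc k s)]
        simp only [atomicMeasure_apply (hA _)]
      · intro k
        refine Measurable.aemeasurable (Measurable.mul (by fun_prop) ?_)
        refine Finset.measurable_prod _ fun i _ => Measurable.mul ?_ ?_
        · exact (hmodel.measurable_weight _).coe_nnreal_ennreal
        · exact (measurable_one.indicator (hA i)).comp (hmodel.measurable_loc _)
    · intro k k' hkk'
      refine disjoint_left.2 fun s hs hs' => hkk' ?_
      ext i
      exact ((hs.1.2 i).symm.trans (hs'.1.2 i))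
    · intro k
      exact ((hmodel.measurable_size (measurableSet_singleton m)).inter (hZ k)).inter (hD' k)
  rw [← integral_const_mul, integral_eq_lintegral_of_nonneg_ae, measureReal_def, h1]
  · congr 1
    refine lintegral_congr_ae ?_
    filter_upwards [hmodel.crm.finite] with s hs
    have : IsFiniteMeasure (atomicMeasure r loc s) := ⟨hs⟩
    rw [← mul_assoc, ENNReal.ofReal_mul (p := _ * _) (by positivity),
      ENNReal.ofReal_prod_of_nonneg fun i _ => measureReal_nonneg]
    simp [measureReal_def]
  · exact ae_of_all _ fun s => mul_nonneg (by positivity)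
      (mul_nonneg (Real.exp_pos _).le (Finset.prod_nonneg fun i _ => measureReal_nonneg))
  · refine (Measurable.const_mul (Measurable.mul ?_ ?_) _).aestronglyMeasurable
    · exact hTm.neg.exp
    · exact Finset.measurable_prod _ fun i _ => hmodel.crm.measurable_real (hA i)

end Sample

/-! ### Ties and the label of one more element. -/

lemma SameTies.exists_injective {m l : ℕ} {ι : Type*} {x : Fin m → ι} {z : Fin m → Fin l}
    (hz : Function.Surjective z) (h : SameTies x z) :
    ∃ c : Fin l → ι, Function.Injective c ∧ ∀ i, x i = c (z i) := by
  -- The value of block `j` is read off at any of its members; surjectivity of `z` provides one.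
  refine ⟨fun j => x (Function.surjInv hz j), fun j j' hjj' => ?_, fun i => ?_⟩
  · have := (h _ _).1 hjj'
    rwa [Function.surjInv_eq hz, Function.surjInv_eq hz] at this
  · exact (h _ _).2 (Function.surjInv_eq hz _).symm

lemma SameTies.of_injective {m l : ℕ} {ι : Type*} {x : Fin m → ι} {z : Fin m → Fin l}
    {c : Fin l → ι} (hc : Function.Injective c) (h : ∀ i, x i = c (z i)) : SameTies x z :=
  fun a b => by rw [h, h, hc.eq_iff]

lemma clusterSize_pos {m l : ℕ} {z : Fin m → Fin l} (hz : Function.Surjective z) (j : Fin l) :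
    1 ≤ clusterSize z j := by
  obtain ⟨i, hi⟩ := hz j
  exact Finset.card_pos.2 ⟨i, by simpa using hi⟩

section Ties

variable {S : Type*} {M : S → ℕ} {Z : ℕ → S → ℕ}

lemma measurableSet_tiesEvent [MeasurableSpace S] (hZ : ∀ i, Measurable (Z i)) {j : ℕ} {α : Type*} (z : Fin j → α) :
    MeasurableSet (tiesEvent Z z) := by
  have h1 : Measurable fun s (i : Fin j) => Z i s := measurable_pi_lambda _ fun i => hZ i
  exact h1 (MeasurableSet.of_discrete (s := {x : Fin j → ℕ | SameTies x z}))

lemma mem_tiesEvent_addElement {m l : ℕ} {z : Fin m → Fin l} {k : Fin (l + 1)} {s : S} :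
    s ∈ tiesEvent Z (addElement z k) ↔
      s ∈ tiesEvent Z z ∧ ∀ i : Fin m, Z m s = Z i s ↔ k = (z i).castSucc := by
  constructor
  · intro h
    refine ⟨fun a b => ?_, fun i => ?_⟩
    · have := h a.castSucc b.castSucc
      simpa [addElement] using this
    · have := h (Fin.last m) i.castSucc
      simpa [addElement] using this
  · rintro ⟨h1, h2⟩ a b
    refine Fin.lastCases ?_ (fun a => ?_) a <;> refine Fin.lastCases ?_ (fun b => ?_) b
    · simp
    · simpa [addElement] using h2 b
    · have := h2 a
      simp only [addElement, Fin.snoc_castSucc, Fin.snoc_last, Fin.val_castSucc, Fin.val_last]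
      rw [eq_comm, this, eq_comm]
    · simpa [addElement] using h1 a b

lemma tiesEvent_eq_iUnion {m l : ℕ} (z : Fin m → Fin l) :
    tiesEvent Z z = ⋃ k, tiesEvent Z (addElement z k) := by
  ext s
  simp only [mem_iUnion, mem_tiesEvent_addElement]
  constructor
  · intro h
    by_cases hex : ∃ i : Fin m, Z m s = Z i s
    · obtain ⟨i, hi⟩ := hex
      refine ⟨(z i).castSucc, h, fun i' => ?_⟩
      rw [hi, Fin.castSucc_inj]
      exact h i i'
    · push Not at hex
      exact ⟨Fin.last l, h, fun i => iff_of_false (hex i) (Fin.castSucc_lt_last _).ne'⟩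
  · rintro ⟨k, h, -⟩
    exact h

lemma pairwise_disjoint_tiesEvent_addElement {m l : ℕ} {z : Fin m → Fin l}
    (hz : Function.Surjective z) :
    Pairwise (Function.onFun Disjoint fun k => tiesEvent Z (addElement z k)) := by
  intro k k' hkk'
  refine disjoint_left.2 fun s hs hs' => hkk' ?_
  have h1 := (mem_tiesEvent_addElement.1 hs).2
  have h2 := (mem_tiesEvent_addElement.1 hs').2
  have h3 : ∀ j : Fin l, k = j.castSucc ↔ k' = j.castSucc := fun j => by
    obtain ⟨i, rfl⟩ := hz j
    rw [← h1, ← h2]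
  induction k using Fin.lastCases with
  | last =>
    induction k' using Fin.lastCases with
    | last => rfl
    | cast j => exact (h3 j).2 rfl
  | cast j => exact ((h3 j).1 rfl).symm

lemma ecpf_eq_sum_addElement [MeasurableSpace S] (P : Measure S) [IsFiniteMeasure P] (hM : Measurable M)
    (hZ : ∀ i, Measurable (Z i)) (n : ℕ) {m l : ℕ} {z : Fin m → Fin l}
    (hz : Function.Surjective z) :
    ecpf P M Z n z = ∑ k, ecpf P M Z n (addElement z k) := by
  simp only [ecpf]
  rw [tiesEvent_eq_iUnion, inter_iUnion, measureReal_iUnion_fintype]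
  · exact fun k k' hkk' => (pairwise_disjoint_tiesEvent_addElement hz hkk').mono
      inter_subset_right inter_subset_right
  · exact fun k => (hM (measurableSet_singleton n)).inter (measurableSet_tiesEvent hZ _)

end Ties

/-! ### The product formula for the ECPF. -/

section Formula

variable {S Ω : Type*} [MeasurableSpace S] [MeasurableSpace Ω] {P : Measure S}
  [IsProbabilityMeasure P] {ρ : Measure ℝ} {G₀ : Measure Ω} [IsFiniteMeasure G₀]
  {r : ℕ → S → ℝ≥0} {loc : ℕ → S → Ω} {M : S → ℕ} {Z : ℕ → S → ℕ}
  (hρ : IsSubordinatorMeasure (ρ.restrict (Ioi 0)))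
  (hmodel : IsCountMixture P ρ G₀ r loc M Z)
include hρ hmodel

/-- Grouping the factors by cell gives exponents equal to block sizes; cells outside the range of
`c` have exponent 0 and normalized moment 1. -/
lemma integral_exp_neg_mul_prod_injective {ι : Type*} [Fintype ι] [MeasurableSpace ι]
    [MeasurableSingletonClass ι] {φ : Ω → ι} (hφ : Measurable φ) {m l : ℕ} (z : Fin m → Fin l)
    {c : Fin l → ι} (hc : Function.Injective c) :
    ∫ s, Real.exp (-(atomicMeasure r loc s).real univ) *
        ∏ i, (atomicMeasure r loc s).real (φ ⁻¹' {c (z i)}) ∂P =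
      Real.exp (G₀.real univ * laplaceRate ρ) * ∏ j, normalizedMoment P ρ G₀
        (atomicMeasure r loc) (φ ⁻¹' {c j}) (clusterSize z j) := by
  classical
  have hm : ∀ x, MeasurableSet (φ ⁻¹' {x}) := fun x => hφ (measurableSet_singleton x)
  set n : ι → ℕ := fun x => (Finset.univ.filter fun i => c (z i) = x).card with hn
  have h1 : ∀ s, ∏ i, (atomicMeasure r loc s).real (φ ⁻¹' {c (z i)}) =
      ∏ x, (atomicMeasure r loc s).real (φ ⁻¹' {x}) ^ n x := fun s => by
    rw [← Finset.prod_fiberwise' Finset.univ (fun i => c (z i))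
      fun x => (atomicMeasure r loc s).real (φ ⁻¹' {x})]
    simp [hn]
  have h2 := integral_exp_neg_mul_prod_pow hmodel.crm hm
    (fun x y hxy => Disjoint.preimage _ (by simpa using hxy))
    (by rw [← preimage_iUnion, iUnion_of_singleton, preimage_univ]) n
  simp only [h1, h2]
  congr 1
  rw [← Finset.prod_subset (Finset.subset_univ (Finset.univ.image c)),
    Finset.prod_image fun i _ j _ hij => hc hij]
  · refine Finset.prod_congr rfl fun j _ => ?_
    simp only [hn, hc.eq_iff]
    rfl
  · intro x _ hx
    have : n x = 0 := by
      refine Finset.card_eq_zero.2 (Finset.filter_eq_empty_iff.2 fun i _ hi => hx ?_)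
      exact Finset.mem_image.2 ⟨z i, Finset.mem_univ _, hi⟩
    rw [this, normalizedMoment_zero hρ hmodel.crm (hm x)]

/-- The law of the sample size and of the partition by the cells of the sampled atoms. -/
lemma measureReal_cell_ties {ι : Type*} [Fintype ι] [MeasurableSpace ι]
    [MeasurableSingletonClass ι] {φ : Ω → ι} (hφ : Measurable φ) {m l : ℕ} {z : Fin m → Fin l}
    (hz : Function.Surjective z) (hloc : ∀ i : Fin m, Measurable fun s => loc (Z i s) s) :
    P.real {s | M s = m ∧ SameTies (fun i : Fin m => φ (loc (Z i s) s)) z} =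
      (m.factorial : ℝ)⁻¹ * Real.exp (G₀.real univ * laplaceRate ρ) *
        injSum fun j c => normalizedMoment P ρ G₀ (atomicMeasure r loc) (φ ⁻¹' {c})
          (clusterSize z j) := by
  classical
  have hm : ∀ x, MeasurableSet (φ ⁻¹' {x}) := fun x => hφ (measurableSet_singleton x)
  have h1 : {s | M s = m ∧ SameTies (fun i : Fin m => φ (loc (Z i s) s)) z} =
      ⋃ c ∈ Finset.univ.filter fun c : Fin l → ι => Function.Injective c,
        {s | M s = m ∧ ∀ i : Fin m, loc (Z i s) s ∈ φ ⁻¹' {c (z i)}} := by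
    ext s
    simp only [mem_ofPred_eq, mem_iUnion, Finset.mem_filter, Finset.mem_univ, true_and,
      exists_prop, mem_preimage, mem_singleton_iff]
    constructor
    · rintro ⟨hM, h⟩
      obtain ⟨c, hc, hcz⟩ := h.exists_injective hz
      exact ⟨c, hc, hM, hcz⟩
    · rintro ⟨c, hc, hM, hcz⟩
      exact ⟨hM, SameTies.of_injective hc hcz⟩
  rw [h1, measureReal_biUnion_finset, injSum, ← Finset.sum_filter, Finset.mul_sum]
  · refine Finset.sum_congr rfl fun c hc => ?_
    rw [measureReal_sample_mem hmodel fun i => hm _,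
      integral_exp_neg_mul_prod_injective hρ hmodel hφ z (Finset.mem_filter.1 hc).2, mul_assoc]
  · intro c _ c' _ hcc'
    refine disjoint_left.2 fun s hs hs' => hcc' ?_
    ext j
    obtain ⟨i, rfl⟩ := hz j
    exact (hs.2 i).symm.trans (hs'.2 i)
  · intro c _
    refine (hmodel.measurable_size (measurableSet_singleton m)).inter ?_
    have : {s | ∀ i : Fin m, loc (Z i s) s ∈ φ ⁻¹' {c (z i)}} =
        ⋂ i : Fin m, (fun s => loc (Z i s) s) ⁻¹' (φ ⁻¹' {c (z i)}) := by ext s; simp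
    change MeasurableSet {s | ∀ i : Fin m, loc (Z i s) s ∈ φ ⁻¹' {c (z i)}}
    rw [this]
    exact MeasurableSet.iInter fun i => hloc i (hm _)

/-- The exchangeable cluster probability function of the count-mixture model. -/
theorem ecpf_eq_prod [MeasurableSpace.CountablySeparated Ω] [NullSingletonClass G₀] {m l : ℕ}
    {z : Fin m → Fin l} (hz : Function.Surjective z) :
    ecpf P M Z m z = (m.factorial : ℝ)⁻¹ * Real.exp (G₀.real univ * laplaceRate ρ) *
      ∏ j, G₀.real univ * kappa ρ (clusterSize z j) := by
  obtain ⟨φ, hφ⟩ := exists_isSeparatingSequence Ω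
  have hloc : ∀ i, Measurable fun s => loc (Z i s) s := fun i => by
    have h1 : Measurable fun p : ℕ × S => loc p.1 p.2 :=
      measurable_from_prod_countable_right hmodel.measurable_loc
    exact h1.comp ((hmodel.measurable_indicator i).prodMk measurable_id)
  have h1 : ∀ N, MeasurableSet
      {s | M s = m ∧ SameTies (fun i : Fin m => φ N (loc (Z i s) s)) z} := fun N => by
    have h2 : Measurable fun s (i : Fin m) => φ N (loc (Z i s) s) :=
      measurable_pi_lambda _ fun i => (hφ.measurable N).comp (hloc i)
    exact (hmodel.measurable_size (measurableSet_singleton m)).inter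
      (h2 (MeasurableSet.of_discrete (s := {x : Fin m → Fin N → Bool | SameTies x z})))
  have h2 : MeasurableSet ({s | M s = m} ∩ tiesEvent Z z) :=
    (hmodel.measurable_size (measurableSet_singleton m)).inter
      (measurableSet_tiesEvent hmodel.measurable_indicator z)
  -- Sampled indices a.s. carry positive weight, so different indices sit at different points; for
  -- large `N` the cells separate these finitely many points and cell ties equal indicator ties.
  have h3 := tendsto_measure_of_ae_tendsto_indicator_of_isFiniteMeasure (μ := P) atTop h2 h1 (by
    filter_upwards [hmodel.distinct_atoms, ae_weight_ne_zero hmodel m] with s hd hw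
    by_cases hM : M s = m
    · have h4 : ∀ a b : Fin m, ∀ᶠ N in atTop,
          (φ N (loc (Z a s) s) = φ N (loc (Z b s) s) ↔ Z a s = Z b s) := fun a b => by
        by_cases hab : Z a s = Z b s
        · exact Eventually.of_forall fun N => by simp [hab]
        · have h5 : loc (Z a s) s ≠ loc (Z b s) s := fun h6 =>
            hab (hd _ _ (hw hM a) (hw hM b) h6)
          filter_upwards [hφ.separates _ _ h5] with N hN
          exact iff_of_false hN hab
      have h5 := eventually_all.2 fun a => eventually_all.2 (h4 a)
      filter_upwards [h5] with N hN
      simp only [mem_ofPred_eq, mem_inter_iff, tiesEvent, SameTies, hN]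
    · exact Eventually.of_forall fun N => by simp [hM])
  have h4 := (ENNReal.tendsto_toReal (measure_ne_top P _)).comp h3
  have h5 := (hφ.tendsto_injSum_normalizedMoment hρ hmodel.crm (clusterSize z)
    (clusterSize_pos hz)).const_mul
      ((m.factorial : ℝ)⁻¹ * Real.exp (G₀.real univ * laplaceRate ρ))
  refine tendsto_nhds_unique (h4.congr fun N => ?_) h5
  exact measureReal_cell_ties hρ hmodel (hφ.measurable N) hz fun i => hloc i

end Formula

/-! ### Effect of one more element on the ECPF. -/

lemma clusterSize_snoc {m l : ℕ} (z : Fin m → Fin l) (j k : Fin l) :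
    clusterSize (Fin.snoc (α := fun _ => Fin l) z j) k =
      clusterSize z k + if j = k then 1 else 0 := by
  rw [clusterSize, clusterSize, Finset.card_filter, Finset.card_filter, Fin.sum_univ_castSucc]
  simp only [Fin.snoc_castSucc, Fin.snoc_last]

lemma clusterSize_addElement_last_castSucc {m l : ℕ} (z : Fin m → Fin l) (j : Fin l) :
    clusterSize (addElement z (Fin.last l)) j.castSucc = clusterSize z j := by
  rw [addElement, clusterSize_snoc, if_neg (Fin.castSucc_lt_last j).ne']
  simp [clusterSize]

lemma clusterSize_addElement_last_last {m l : ℕ} (z : Fin m → Fin l) :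
    clusterSize (addElement z (Fin.last l)) (Fin.last l) = 1 := by
  rw [addElement, clusterSize_snoc, if_pos rfl]
  simp [clusterSize, (Fin.castSucc_lt_last _).ne]

lemma surjective_addElement_last {m l : ℕ} {z : Fin m → Fin l} (hz : Function.Surjective z) :
    Function.Surjective (addElement z (Fin.last l)) := by
  intro k
  induction k using Fin.lastCases with
  | last => exact ⟨Fin.last m, by simp [addElement]⟩
  | cast j =>
    obtain ⟨i, rfl⟩ := hz j
    exact ⟨i.castSucc, by simp [addElement]⟩

lemma surjective_snoc {m l : ℕ} {z : Fin m → Fin l} (hz : Function.Surjective z) (j : Fin l) :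
    Function.Surjective (Fin.snoc (α := fun _ => Fin l) z j) := by
  intro k
  obtain ⟨i, rfl⟩ := hz k
  exact ⟨i.castSucc, by simp⟩

/-- When an old block is joined, `Fin.last l` is not used as a label; relabelling in `Fin l`
restores the surjectivity required by `ecpf_eq_prod`. -/
lemma tiesEvent_addElement_castSucc {S : Type*} (Z : ℕ → S → ℕ) {m l : ℕ} (z : Fin m → Fin l)
    (j : Fin l) : tiesEvent Z (addElement z j.castSucc) =
      tiesEvent Z (Fin.snoc (α := fun _ => Fin l) z j) := by
  have h : addElement z j.castSucc =
      fun i => (Fin.snoc (α := fun _ => Fin l) z j i : Fin l).castSucc := by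
    ext i
    refine Fin.lastCases ?_ (fun i => ?_) i <;> simp [addElement]
  rw [h]
  ext s
  simp [tiesEvent, SameTies]

section Prediction

variable {S Ω : Type*} [MeasurableSpace S] [MeasurableSpace Ω]
  [MeasurableSpace.CountablySeparated Ω] {P : Measure S}
  [IsProbabilityMeasure P] {ρ : Measure ℝ} {G₀ : Measure Ω} [IsFiniteMeasure G₀]
  [NullSingletonClass G₀] {r : ℕ → S → ℝ≥0} {loc : ℕ → S → Ω} {M : S → ℕ} {Z : ℕ → S → ℕ}

/-- Adding an element multiplies the exchangeable cluster probability function by the prediction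
weight, up to the size factor. -/
theorem ecpf_addElement (hρ : IsSubordinatorMeasure (ρ.restrict (Ioi 0)))
    (hmodel : IsCountMixture P ρ G₀ r loc M Z) (hκ : ∀ n, 1 ≤ n → 0 < kappa ρ n)
    {m l : ℕ} {z : Fin m → Fin l} (hz : Function.Surjective z) (k : Fin (l + 1)) :
    ecpf P M Z (m + 1) (addElement z k) =
      ecpf P M Z m z / (m + 1) * predictionWeight (G₀.real univ) ρ z k := by
  rw [ecpf_eq_prod hρ hmodel hz]
  have hfac : ((m + 1).factorial : ℝ)⁻¹ = (m.factorial : ℝ)⁻¹ / (m + 1) := by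
    rw [Nat.factorial_succ, Nat.cast_mul, mul_inv]
    push_cast
    ring
  induction k using Fin.lastCases with
  | last =>
    rw [ecpf_eq_prod hρ hmodel (surjective_addElement_last hz), Fin.prod_univ_castSucc,
      clusterSize_addElement_last_last, hfac]
    simp only [clusterSize_addElement_last_castSucc, predictionWeight, Fin.snoc_last]
    ring
  | cast j =>
    rw [ecpf, tiesEvent_addElement_castSucc, ← ecpf, ecpf_eq_prod hρ hmodel (surjective_snoc hz j),
      hfac]
    have h1 : ∏ j', G₀.real univ * kappa ρ (clusterSize (Fin.snoc (α := fun _ => Fin l) z j) j') =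
        (∏ j', G₀.real univ * kappa ρ (clusterSize z j')) *
          (kappa ρ (clusterSize z j + 1) / kappa ρ (clusterSize z j)) := by
      -- Only the factor of block `j` changes, so it is isolated on both sides.
      rw [← Finset.mul_prod_erase _ _ (Finset.mem_univ j),
        ← Finset.mul_prod_erase _ (fun j' => G₀.real univ * kappa ρ (clusterSize z j'))
          (Finset.mem_univ j), clusterSize_snoc, if_pos rfl]
      have h2 : ∏ j' ∈ Finset.univ.erase j,
          G₀.real univ * kappa ρ (clusterSize (Fin.snoc (α := fun _ => Fin l) z j) j') =
          ∏ j' ∈ Finset.univ.erase j, G₀.real univ * kappa ρ (clusterSize z j') :=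
        Finset.prod_congr rfl fun j' hj' => by
          rw [clusterSize_snoc, if_neg (Finset.ne_of_mem_erase hj').symm, add_zero]
      rw [h2]
      have h3 := (hκ _ (clusterSize_pos hz j)).ne'
      field_simp
    rw [h1, predictionWeight, Fin.snoc_castSucc]
    ring

lemma ecpf_pos (hρ : IsSubordinatorMeasure (ρ.restrict (Ioi 0)))
    (hmodel : IsCountMixture P ρ G₀ r loc M Z) (hκ : ∀ n, 1 ≤ n → 0 < kappa ρ n)
    (hG₀ : G₀ ≠ 0) {m l : ℕ} {z : Fin m → Fin l} (hz : Function.Surjective z) :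
    0 < ecpf P M Z m z := by
  rw [ecpf_eq_prod hρ hmodel hz]
  have h1 : 0 < G₀.real univ := by
    have : NeZero G₀ := ⟨hG₀⟩
    exact measureReal_univ_pos
  exact mul_pos (by positivity)
    (Finset.prod_pos fun j _ => mul_pos h1 (hκ _ (clusterSize_pos hz j)))

end Prediction

end

end CountMixture

/-! ### The size-dependent EPPF and the prediction rule. -/

theorem mainTheorem5 {S Ω : Type*} [MeasurableSpace S] [MeasurableSpace Ω]
    [MeasurableSpace.CountablySeparated Ω]
    (P : Measure S) [IsProbabilityMeasure P]
    (ρ : Measure ℝ) (hρ : ∫⁻ r in Ioi (0 : ℝ), ENNReal.ofReal (min 1 r) ∂ρ < ∞)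
    (hρ0 : ρ (Ioi 0) ≠ 0)
    (G₀ : Measure Ω) [IsFiniteMeasure G₀] [NullSingletonClass G₀] (hG₀ : G₀ ≠ 0)
    (r : ℕ → S → ℝ≥0) (loc : ℕ → S → Ω) (M : S → ℕ) (Z : ℕ → S → ℕ)
    (hmodel : IsCountMixture P ρ G₀ r loc M Z)
    (m l : ℕ) (z : Fin m → Fin l) (hz : Function.Surjective z) :
    (∀ n : ℕ, 1 ≤ n → 0 < kappa ρ n) ∧
    0 < sizePMF P M m ∧ 0 < sizePMF P M (m + 1) ∧ 0 < ecpf P M Z (m + 1) z ∧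
    eppf P M Z (m + 1) z =
      eppf P M Z m z * (sizePMF P M m / ((m + 1 : ℝ) * sizePMF P M (m + 1))) *
        (G₀.real univ * kappa ρ 1 +
          ∑ k, kappa ρ (clusterSize z k + 1) / kappa ρ (clusterSize z k)) ∧
    ∀ k : Fin (l + 1),
      predictive P M Z z k =
        ecpf P M Z (m + 1) (addElement z k) / ecpf P M Z (m + 1) z ∧
      predictive P M Z z k =
        predictionWeight (G₀.real univ) ρ z k /
          ∑ k', predictionWeight (G₀.real univ) ρ z k' := by
  have hρ' := isSubordinatorMeasure_restrict hρ
  have hκ : ∀ n : ℕ, 1 ≤ n → 0 < kappa ρ n := fun n hn => by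
    have hne : ρ.restrict (Ioi 0) ≠ 0 := fun h => hρ0 (Measure.restrict_eq_zero.1 h)
    have := hρ'.tiltedMoment_pos hne (n - 1)
    rwa [Nat.sub_add_cancel hn, tiltedMoment_restrict] at this
  have hM : ∀ n, MeasurableSet {s | M s = n} := fun n =>
    hmodel.measurable_size (measurableSet_singleton n)
  have hγ : 0 < G₀.real univ := by
    have : NeZero G₀ := ⟨hG₀⟩
    exact measureReal_univ_pos
  have hle : ∀ (n : ℕ), ecpf P M Z n z ≤ sizePMF P M n := fun n =>
    measureReal_mono inter_subset_left
  have hp : 0 < ecpf P M Z m z := ecpf_pos hρ' hmodel hκ hG₀ hz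
  have hw : ∀ k, 0 < predictionWeight (G₀.real univ) ρ z k := fun k => by
    induction k using Fin.lastCases with
    | last =>
      rw [predictionWeight, Fin.snoc_last]
      exact mul_pos hγ (hκ 1 le_rfl)
    | cast j =>
      rw [predictionWeight, Fin.snoc_castSucc]
      exact div_pos (hκ _ (by omega)) (hκ _ (clusterSize_pos hz j))
  have hW : 0 < ∑ k, predictionWeight (G₀.real univ) ρ z k :=
    Finset.sum_pos (fun k _ => hw k) ⟨0, Finset.mem_univ _⟩
  -- The last element either joins exactly one old block or opens a new one, so the ECPF is a sum
  -- over its label.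
  have hsum : ecpf P M Z (m + 1) z =
      ecpf P M Z m z / (m + 1) * ∑ k, predictionWeight (G₀.real univ) ρ z k := by
    rw [ecpf_eq_sum_addElement P hmodel.measurable_size hmodel.measurable_indicator _ hz,
      Finset.mul_sum]
    exact Finset.sum_congr rfl fun k _ => ecpf_addElement hρ' hmodel hκ hz k
  have hm1 : (0 : ℝ) < m + 1 := by positivity
  have hp1 : 0 < ecpf P M Z (m + 1) z := by
    rw [hsum]
    exact mul_pos (div_pos hp hm1) hW
  have hf : 0 < sizePMF P M m := hp.trans_le (hle m)
  have hf1 : 0 < sizePMF P M (m + 1) := hp1.trans_le (hle _)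
  have heppf : ∀ n, eppf P M Z n z = (sizePMF P M n)⁻¹ * ecpf P M Z n z := fun n => by
    simp [eppf, measureReal_def, cond_apply (hM n), sizePMF, ecpf]
  refine ⟨hκ, hf, hf1, hp1, ?_, fun k => ?_⟩
  · rw [heppf, heppf, hsum, Fin.sum_univ_castSucc]
    simp only [predictionWeight, Fin.snoc_castSucc, Fin.snoc_last]
    field_simp
    ring
  · have hpred : predictive P M Z z k =
        ecpf P M Z (m + 1) (addElement z k) / ecpf P M Z (m + 1) z := by
      have hE : MeasurableSet ({s | M s = m + 1} ∩ tiesEvent Z z) :=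
        (hM _).inter (measurableSet_tiesEvent hmodel.measurable_indicator z)
      have hinter : {s | M s = m + 1} ∩ tiesEvent Z z ∩ tiesEvent Z (addElement z k) =
          {s | M s = m + 1} ∩ tiesEvent Z (addElement z k) := by
        rw [inter_assoc, inter_eq_right.2 fun s hs => (mem_tiesEvent_addElement.1 hs).1]
      rw [predictive, measureReal_def, cond_apply hE, hinter, ENNReal.toReal_mul, ENNReal.toReal_inv,
        ← div_eq_inv_mul]
      rfl
    refine ⟨hpred, ?_⟩
    -- Numerator and denominator share the positive factor $f(\boldsymbol z,m)/(m+1)$.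
    rw [hpred, ecpf_addElement hρ' hmodel hκ hz, hsum,
      mul_div_mul_left _ _ (div_pos hp hm1).ne']
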